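/- Let $\mathbb F$ be a field that is either algebraically closed (of any characteristic) or equal to $\mathbb R$. Write $e_1,e_2,\dots$ for the standard bases, $V=\mathbb F^2\otimes\mathbb F^3$, and identify $\sum m_{ij}\,e_i\otimes e_j\in V$ with the $2\times 3$ matrix $(m_{ij})$. Let $K=\mathrm{GL}(\mathbb F^2)\times \mathrm{GL}(\mathbb F^3)$ act on $V$ and hence on the subspaces of $\mathrm{PG}(V)=\mathrm{PG}(5,\mathbb F)$; a solid (hyperplane) of $\mathrm{PG}(V)$ is $\mathrm{PG}(U)$ with $U\le V$ of vector space dimension $4$ (resp. $5$). Let $S_{2,3}\subset\mathrm{PG}(V)$ be the Segre variety $\{\langle a\otimes b\rangle\}$ of points of rank one; an $S_{m,n}$ contained in it is a set $\{\langle a\otimes b\rangle : 0\ne a\in A,\ 0\ne b\in B\}$ with $A\le\mathbb F^2$, $B\le\mathbb F^3$, $\dim A=m$, $\dim B=n$, and it spans $\mathrm{PG}(A\otimes B)$. For a tensor $A\in\mathbb F^2\otimes\mathbb F^3\otimes\mathbb F^3$ let $A_2=\{\varphi(A):\varphi\in(\mathbb F^3)^\vee\}\le V$ be its second contraction space, where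 $\varphi(a\otimes b\otimes c)=\varphi(b)\,a\otimes c$. Fix nondegenerate symmetric bilinear forms $\beta_1$ on $\mathbb F^2$ and $\beta_2$ on $\mathbb F^3$ and let $\perp$ be taken with respect to the form $\beta$ on $V$ with $\beta(a\otimes b,c\otimes d)=\beta_1(a,c)\beta_2(b,d)$. With $e_{ijk}=e_i\otimes e_j\otimes e_k$, let $o_i$ be the set of tensors that are equivalent under $\mathrm{GL}(\mathbb F^2)\times\mathrm{GL}(\mathbb F^3)\times\mathrm{GL}(\mathbb F^3)$ to one of the following: - $o_1$: $e_{111}$; - $o_2$: $e_{111}+e_{122}$; - $o_4$: $e_{111}+e_{212}$; - $o_4^T$: $e_{111}+e_{221}$; - $o_5$: $e_{111}+e_{222}$; - $o_6$: $e_{111}+e_{212}+e_{221}$; - $o_7$: $e_{113}+e_{211}+e_{222}$; - $o_{10}$: $e_{111}+e_{122}+u\,e_{112}+e_{212}+v\,e_{221}$, for any $u,v\in\mathbb F$ such that $v\neq0$ and $v\lambda^2+uv\lambda-1\ne0$ for all $\lambda\in\mathbb F$; - $o_{11}$: $e_{111}+e_{122}+e_{212}+e_{223}$. Let $o_i^\perp$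 be the set of all subspaces of $\mathrm{PG}(V)$ that are $K$-equivalent to $\mathrm{PG}(A_2^\perp)$ for some $A\in o_i$. **(a)** If $\mathbb F$ is algebraically closed, there are exactly $6$ $K$-orbits of solids and exactly $2$ $K$-orbits of hyperplanes in $\mathrm{PG}(V)$. The set $o_{10}^\perp$ is empty; the orbits of solids are $o_2^\perp,(o_4^T)^\perp,o_5^\perp,o_6^\perp,o_7^\perp,o_{11}^\perp$, pairwise distinct; and the orbits of hyperplanes are $o_1^\perp$ and $o_4^\perp$, which are distinct. **(b)** If $\mathbb F=\mathbb R$, there are exactly $7$ $K$-orbits of solids and exactly $2$ $K$-orbits of hyperplanes in $\mathrm{PG}(V)$. The orbits of solids are $o_2^\perp,(o_4^T)^\perp,o_5^\perp,o_6^\perp,o_7^\perp,o_{10}^\perp,o_{11}^\perp$, pairwise distinct, and the orbits of hyperplanes are $o_1^\perp$ and $o_4^\perp$, which are distinct. In both cases the orbits that occur are described by the following tables: the listed subspaces, in which $x,y,z,w,t$ run over $\mathbb F$, belong to the orbit; every member of the orbit meets $S_{2,3}$ in a set as stated; and for every member $\mathrm{PG}(U)$ of the orbit there is a smallest Segre variety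 contained in $S_{2,3}$ whose span contains $\mathrm{PG}(U)$, and it is of the type in the column "Min". Solids: | orbit | intersection with $S_{2,3}$ | Min | representative | |---|---|---|---| | $o_2^\perp$ | the union of a plane and a line not contained in it | $S_{2,3}$ | $\begin{bmatrix}0&0&x\\y&z&w\end{bmatrix}$ | | $(o_4^T)^\perp$ | an $S_{2,2}$ | $S_{2,2}$ | $\begin{bmatrix}0&x&y\\0&z&w\end{bmatrix}$ | | $o_5^\perp$ | the union of three distinct lines | $S_{2,3}$ | $\begin{bmatrix}0&x&y\\z&0&w\end{bmatrix}$ | | $o_6^\perp$ | the union of two distinct intersecting lines | $S_{2,3}$ | $\begin{bmatrix}x&y&z\\0&-x&w\end{bmatrix}$ | | $o_7^\perp$ | the union of a conic and a line | $S_{2,3}$ | $\begin{bmatrix}x&0&y\\z&w&-x\end{bmatrix}$ | | $o_{10}^\perp$ | a line | $S_{2,3}$ | $\begin{bmatrix}x&-vy&z\\y&-x+uvy&w\end{bmatrix}$, for all $u,v$ with $v\ne0$ and $v\lambda^2+uv\lambda-1\neq0$ for all $\lambda\in\mathbb F$ | | $o_{11}^\perp$ | a normal rational curve of degree $3$ |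 $S_{2,3}$ | $\begin{bmatrix}x&y&z\\w&-x&-y\end{bmatrix}$ | Hyperplanes: | orbit | intersection with $S_{2,3}$ | Min | representative | |---|---|---|---| | $o_1^\perp$ | the union of a plane and an $S_{2,2}$ | $S_{2,3}$ | $\begin{bmatrix}0&x&y\\z&w&t\end{bmatrix}$ | | $o_4^\perp$ | a cubic scroll | $S_{2,3}$ | $\begin{bmatrix}x&y&z\\w&-x&t\end{bmatrix}$ | Here a normal rational curve of degree $n$ is a set $\{\langle\sum_{i=0}^n a^{n-i}b^i f_i\rangle : (a,b)\ne(0,0)\}$ with $f_0,\dots,f_n\in V$ linearly independent, a conic is one of degree $2$, and a cubic scroll is a set $\{\langle s(ag_0+bg_1)+r(a^2f_0+abf_1+b^2f_2)\rangle : (a,b)\ne(0,0)\ne(s,r)\}$ with $g_0,g_1,f_0,f_1,f_2\in V$ linearly independent. -/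

import Mathlib

open scoped TensorProduct LinearAlgebra.Projectivization

universe u

namespace SegreTwoThree

/-- The tensor product `F² ⊗ F³`; the projective space `PG(F² ⊗ F³)` is `ℙ F (V F)`. -/
abbrev V (F : Type u) [Field F] : Type u := (Fin 2 → F) ⊗[F] (Fin 3 → F)

/-- The tensor product `F² ⊗ F³ ⊗ F³`. -/
abbrev T3 (F : Type u) [Field F] : Type u :=
  (Fin 2 → F) ⊗[F] ((Fin 3 → F) ⊗[F] (Fin 3 → F))

noncomputable section

variable {F : Type u} [Field F]

/-! ### The group action on subspaces, solids and hyperplanes -/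

/-- The orbit of a subspace `U` of `F² ⊗ F³` under `GL(F²) × GL(F³)`. The scalars of each factor
fix every subspace, so this is also the orbit of `PG(U)` under the induced projective group. -/
def subspaceOrbit (U : Submodule F (V F)) : Set (Submodule F (V F)) :=
  {W | ∃ (g : (Fin 2 → F) ≃ₗ[F] (Fin 2 → F)) (h : (Fin 3 → F) ≃ₗ[F] (Fin 3 → F)),
    W = U.map (TensorProduct.congr g h).toLinearMap}

/-- The set of orbits of solids of `PG(F² ⊗ F³)`: subspaces of vector dimension `4`. -/
def solidOrbits (F : Type u) [Field F] : Set (Set (Submodule F (V F))) :=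
  {O | ∃ U : Submodule F (V F), Module.finrank F U = 4 ∧ O = subspaceOrbit U}

/-- The set of orbits of hyperplanes of `PG(F² ⊗ F³)`: subspaces of vector dimension `5`. -/
def hyperplaneOrbits (F : Type u) [Field F] : Set (Set (Submodule F (V F))) :=
  {O | ∃ U : Submodule F (V F), Module.finrank F U = 5 ∧ O = subspaceOrbit U}

/-! ### Orbits of tensors, contraction spaces, and their perps -/

/-- The tensor `e_(i+1) ⊗ e_(j+1) ⊗ e_(k+1)` of `F² ⊗ F³ ⊗ F³`. -/
def e3 (F : Type u) [Field F] (i : Fin 2) (j k : Fin 3) : T3 F :=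
  (Pi.single i 1 : Fin 2 → F) ⊗ₜ[F]
    ((Pi.single j 1 : Fin 3 → F) ⊗ₜ[F] (Pi.single k 1 : Fin 3 → F))

/-- The linear map `a ⊗ b ⊗ c ↦ a ⊗ c ⊗ b`. -/
def transposeTensor : T3 F →ₗ[F] T3 F :=
  LinearMap.lTensor (Fin 2 → F) (TensorProduct.comm F (Fin 3 → F) (Fin 3 → F)).toLinearMap

/-- Contraction in the second factor: `a ⊗ b ⊗ c ↦ φ(b) a ⊗ c`. -/
def contract2 (φ : Module.Dual F (Fin 3 → F)) : T3 F →ₗ[F] V F :=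
  LinearMap.lTensor (Fin 2 → F)
    ((TensorProduct.lid F (Fin 3 → F)).toLinearMap ∘ₗ LinearMap.rTensor (Fin 3 → F) φ)

/-- The second contraction space of a tensor. -/
def contractionSpace2 (A : T3 F) : Submodule F (V F) :=
  Submodule.span F (Set.range fun φ : Module.Dual F (Fin 3 → F) => contract2 φ A)

/-- The names of the orbits of tensors whose second contraction space is a point or a line. -/
inductive Label
  | o1 | o2 | o4 | o4T | o5 | o6 | o7 | o10 | o11

/-- The condition on the parameters of `o10`: the polynomial `v λ² + u v λ - 1` is quadratic and
has no root in `F`. -/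
def NoRoot (u v : F) : Prop :=
  v ≠ 0 ∧ ∀ l : F, v * l ^ 2 + u * v * l - 1 ≠ 0

/-- The canonical forms of the orbits of tensors; `o10` has one for each admissible pair of
parameters. -/
def canonicalForms (F : Type u) [Field F] : Label → Set (T3 F)
  | .o1 => {e3 F 0 0 0}
  | .o2 => {e3 F 0 0 0 + e3 F 0 1 1}
  | .o4 => {e3 F 0 0 0 + e3 F 1 0 1}
  | .o4T => {transposeTensor (e3 F 0 0 0 + e3 F 1 0 1)}
  | .o5 => {e3 F 0 0 0 + e3 F 1 1 1}
  | .o6 => {e3 F 0 0 0 + (e3 F 1 0 1 + e3 F 1 1 0)}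
  | .o7 => {e3 F 0 0 2 + (e3 F 1 0 0 + e3 F 1 1 1)}
  | .o10 => {A | ∃ u v : F, NoRoot u v ∧
      A = (e3 F 0 0 0 + e3 F 0 1 1 + u • e3 F 0 0 1) + (e3 F 1 0 1 + v • e3 F 1 1 0)}
  | .o11 => {(e3 F 0 0 0 + e3 F 0 1 1) + (e3 F 1 0 1 + e3 F 1 1 2)}

/-- The set of tensors equivalent under `GL(F²) × GL(F³) × GL(F³)` to a canonical form. -/
def tensorOrbit (F : Type u) [Field F] (l : Label) : Set (T3 F) :=
  {A | ∃ C ∈ canonicalForms F l, ∃ (g : (Fin 2 → F) ≃ₗ[F] (Fin 2 → F))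
    (h k : (Fin 3 → F) ≃ₗ[F] (Fin 3 → F)),
      A = TensorProduct.congr g (TensorProduct.congr h k) C}

/-- The orthogonal space with respect to `β(a ⊗ b, c ⊗ d) = β₁(a, c) β₂(b, d)`. -/
def perp (β₁ : LinearMap.BilinForm F (Fin 2 → F)) (β₂ : LinearMap.BilinForm F (Fin 3 → F))
    (U : Submodule F (V F)) : Submodule F (V F) :=
  LinearMap.BilinForm.orthogonal (LinearMap.BilinForm.tmul β₁ β₂) U

/-- The orbit `oᵢ^⊥`: all subspaces equivalent to the perp of the second contraction space of a
tensor in `oᵢ`. -/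
def perpOrbit (β₁ : LinearMap.BilinForm F (Fin 2 → F)) (β₂ : LinearMap.BilinForm F (Fin 3 → F))
    (l : Label) : Set (Submodule F (V F)) :=
  {W | ∃ A ∈ tensorOrbit F l, W ∈ subspaceOrbit (perp β₁ β₂ (contractionSpace2 A))}

/-- The labels of the rows in the table of solids. -/
def solidLabels : Set Label := {.o2, .o4T, .o5, .o6, .o7, .o10, .o11}

/-- The labels of the rows in the table of hyperplanes. -/
def hyperplaneLabels : Set Label := {.o1, .o4}

/-! ### The column of representatives -/

/-- The tensor `∑ Mᵢⱼ eᵢ ⊗ eⱼ` of a `2 × 3` matrix. -/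
def toTensor (M : Matrix (Fin 2) (Fin 3) F) : V F :=
  ∑ i, ∑ j, M i j • ((Pi.single i 1 : Fin 2 → F) ⊗ₜ[F] (Pi.single j 1 : Fin 3 → F))

/-- The representatives `oᵢ^⊥` listed in the tables of solids and hyperplanes. -/
def tableRep (F : Type u) [Field F] : Label → Set (Submodule F (V F))
  | .o1 => {Submodule.span F {t | ∃ x y z w r : F, t = toTensor !![0, x, y; z, w, r]}}
  | .o2 => {Submodule.span F {t | ∃ x y z w : F, t = toTensor !![0, 0, x; y, z, w]}}
  | .o4 => {Submodule.span F {t | ∃ x y z w r : F, t = toTensor !![x, y, z; w, -x, r]}}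
  | .o4T => {Submodule.span F {t | ∃ x y z w : F, t = toTensor !![0, x, y; 0, z, w]}}
  | .o5 => {Submodule.span F {t | ∃ x y z w : F, t = toTensor !![0, x, y; z, 0, w]}}
  | .o6 => {Submodule.span F {t | ∃ x y z w : F, t = toTensor !![x, y, z; 0, -x, w]}}
  | .o7 => {Submodule.span F {t | ∃ x y z w : F, t = toTensor !![x, 0, y; z, w, -x]}}
  | .o10 => {R | ∃ u v : F, NoRoot u v ∧ R = Submodule.span F
      {t | ∃ x y z w : F, t = toTensor !![x, -(v * y), z; y, -x + u * v * y, w]}}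
  | .o11 => {Submodule.span F {t | ∃ x y z w : F, t = toTensor !![x, y, z; w, -x, -y]}}

/-! ### The column of intersections with the Segre variety -/

/-- The set of points of the projective subspace `PG(U)`. -/
def pg (U : Submodule F (V F)) : Set (ℙ F (V F)) := {p | p.submodule ≤ U}

/-- The points `⟨a ⊗ b⟩` with `a` in `F²` and `b` in a given subspace of `F³`. -/
def segreOver (B : Submodule F (Fin 3 → F)) : Set (ℙ F (V F)) :=
  {p | ∃ (a : Fin 2 → F) (b : Fin 3 → F), a ≠ 0 ∧ b ≠ 0 ∧ b ∈ B ∧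
    p.submodule = Submodule.span F {a ⊗ₜ[F] b}}

/-- The Segre variety `S_{2,3}`. -/
def segre (F : Type u) [Field F] : Set (ℙ F (V F)) := segreOver ⊤

def IsPlane (S : Set (ℙ F (V F))) : Prop :=
  ∃ P : Submodule F (V F), Module.finrank F P = 3 ∧ S = pg P

def IsLine (S : Set (ℙ F (V F))) : Prop :=
  ∃ L : Submodule F (V F), Module.finrank F L = 2 ∧ S = pg L

/-- A Segre variety `S_{2,2}` contained in `S_{2,3}`. -/
def IsSegre22 (S : Set (ℙ F (V F))) : Prop :=
  ∃ B : Submodule F (Fin 3 → F), Module.finrank F B = 2 ∧ S = segreOver B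

/-- A normal rational curve of degree `n` (in the `n`-dimensional projective space spanned by the
linearly independent vectors `f i`). -/
def IsNormalRationalCurve (n : ℕ) (S : Set (ℙ F (V F))) : Prop :=
  ∃ f : Fin (n + 1) → V F, LinearIndependent F f ∧
    S = {p | ∃ a b : F, (a ≠ 0 ∨ b ≠ 0) ∧
      p.submodule = Submodule.span F {∑ i : Fin (n + 1), (a ^ (n - (i : ℕ)) * b ^ (i : ℕ)) • f i}}

def IsConic (S : Set (ℙ F (V F))) : Prop := IsNormalRationalCurve 2 S

/-- A cubic scroll in a 4-dimensional projective space: the union of the lines joining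
corresponding points of a line and a conic lying in complementary subspaces. -/
def IsCubicScroll (S : Set (ℙ F (V F))) : Prop :=
  ∃ (e : Fin 2 → V F) (f : Fin 3 → V F), LinearIndependent F (Sum.elim e f) ∧
    S = {p | ∃ a b s t : F, (a ≠ 0 ∨ b ≠ 0) ∧ (s ≠ 0 ∨ t ≠ 0) ∧
      p.submodule = Submodule.span F
        {s • (a • e 0 + b • e 1) + t • (a ^ 2 • f 0 + (a * b) • f 1 + b ^ 2 • f 2)}}

/-- The description, in the tables, of the set `S` of rank one points of a member of `oᵢ^⊥`. -/
def TableIntersection (S : Set (ℙ F (V F))) : Label → Prop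
  | .o1 => ∃ P Q, IsPlane P ∧ IsSegre22 Q ∧ S = P ∪ Q
  | .o2 => ∃ P L, IsPlane P ∧ IsLine L ∧ ¬ L ⊆ P ∧ S = P ∪ L
  | .o4 => IsCubicScroll S
  | .o4T => IsSegre22 S
  | .o5 => ∃ L₁ L₂ L₃, IsLine L₁ ∧ IsLine L₂ ∧ IsLine L₃ ∧ L₁ ≠ L₂ ∧ L₁ ≠ L₃ ∧ L₂ ≠ L₃ ∧
      S = L₁ ∪ L₂ ∪ L₃
  | .o6 => ∃ L₁ L₂, IsLine L₁ ∧ IsLine L₂ ∧ L₁ ≠ L₂ ∧ (L₁ ∩ L₂).Nonempty ∧ S = L₁ ∪ L₂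
  | .o7 => ∃ C L, IsConic C ∧ IsLine L ∧ S = C ∪ L
  | .o10 => IsLine S
  | .o11 => IsNormalRationalCurve 3 S

/-! ### The column of minimal Segre varieties -/

/-- `A ⊗ B` as a subspace of `F² ⊗ F³`. -/
def tensorSubspace (A : Submodule F (Fin 2 → F)) (B : Submodule F (Fin 3 → F)) :
    Submodule F (V F) :=
  Submodule.map₂ (TensorProduct.mk F (Fin 2 → F) (Fin 3 → F)) A B

/-- The minimal Segre variety contained in `S_{2,3}` whose span contains `PG(U)` is of type
`S_{m,n}`. -/
def MinSegre (U : Submodule F (V F)) (m n : ℕ) : Prop :=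
  ∃ (A : Submodule F (Fin 2 → F)) (B : Submodule F (Fin 3 → F)),
    Module.finrank F A = m ∧ Module.finrank F B = n ∧ U ≤ tensorSubspace A B ∧
    ∀ A' B', U ≤ tensorSubspace A' B' → A ≤ A' ∧ B ≤ B'

/-- The entry of the column `Min` in the tables. -/
def tableMin : Label → ℕ × ℕ
  | .o4T => (2, 2)
  | _ => (2, 3)

/-- Every row of the tables of solids and hyperplanes correctly describes `oᵢ^⊥`: the listed
representatives belong to it, and every member meets the Segre variety as stated and has the
stated minimal Segre variety. -/
def DescribedByTables (β₁ : LinearMap.BilinForm F (Fin 2 → F))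
    (β₂ : LinearMap.BilinForm F (Fin 3 → F)) : Prop :=
  ∀ l : Label, (∀ R ∈ tableRep F l, R ∈ perpOrbit β₁ β₂ l) ∧
    ∀ U ∈ perpOrbit β₁ β₂ l, TableIntersection (pg U ∩ segre F) l ∧
      MinSegre U (tableMin l).1 (tableMin l).2

end

end SegreTwoThree

namespace SegreTwoThree

/-! Everything is transported to spaces of 2 × 3 matrices and then dualised. For the trace form the
adjoint of M ↦ PMQ is M ↦ PᵀMQᵀ, so two subspaces of F² ⊗ F³ are K-equivalent exactly when their
spaces of equations are equivalent under row and column operations (`mem_subspaceOrbit_iff_dualOf`).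
Solids thus become two-dimensional spaces of matrices (pencils), and hyperplanes become single
nonzero matrices up to a scalar. The form β differs from the trace form only by its two Gram
matrices, which are invertible. Hence the equations of the perp of a contraction space form a space
equivalent to the contraction space itself (`dualOf_perp`), and neither β nor the tensors matter any
more (`mem_perpOrbit_iff`).

It remains to classify pencils of 2 × 3 matrices. If some member has rank one, it can be taken to be
E₀₀, and elimination on a second generator leads to o2, o4T, o5, o6 or o7
(`classified_span_rank_one`). Otherwise a member can be taken to be (I | 0); the operations that fix
it conjugate the left 2 × 2 block of the other generator, and its last column decides between o11
and o10 (`classified_span_rank_two`). Single matrices are classified by their rank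
(`matRel_canonical`). Distinct labels are separated by dimension, by common left or right kernels,
and by which members have rank one (`trait_of_mem_pencil`, `eq_of_trait`). Only o10 has parameters:
it is empty over an algebraically closed field because a quadratic has a root, and it is a single
class over ℝ by completing a square (`matEquiv_real_o10`).

The columns of the tables are invariant under K, so one pencil for each canonical form has to be
examined (`table_of_mem_dualOrbit`). The point ⟨a ⊗ b⟩ lies in the solution space of a pencil when
each generator N satisfies aᵀNb = 0. These bilinear equations either split into linear ones or
determine b in terms of a, which gives the parametrisations of the curves and of the scroll. -/

/-- The space of `2 × 3` matrices, identified with `F² ⊗ F³` by `toMat`. -/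
abbrev Mat (F : Type u) : Type u := Matrix (Fin 2) (Fin 3) F

noncomputable section

variable {F : Type u} [Field F]

/-! ### Tensors as matrices -/

/-- The linear map with `a ⊗ b ↦ (aᵢ bⱼ)`. -/
def toMatHom : V F →ₗ[F] Mat F :=
  TensorProduct.lift (LinearMap.mk₂ F Matrix.vecMulVec
    (fun _ _ _ => Matrix.add_vecMulVec _ _ _) (fun _ _ _ => Matrix.smul_vecMulVec _ _ _)
    (fun _ _ _ => Matrix.vecMulVec_add _ _ _) (fun _ _ _ => Matrix.vecMulVec_smul _ _ _))

@[simp] lemma toMatHom_tmul (a : Fin 2 → F) (b : Fin 3 → F) :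
    toMatHom (a ⊗ₜ[F] b) = Matrix.vecMulVec a b := rfl

/-- `toTensor` as a linear map. -/
def toTensorHom : Mat F →ₗ[F] V F where
  toFun := toTensor
  map_add' M N := by simp [toTensor, add_smul, Finset.sum_add_distrib]
  map_smul' c M := by simp [toTensor, mul_smul, Finset.smul_sum]

lemma toMatHom_toTensor (M : Mat F) : toMatHom (toTensor M) = M := by
  ext i j
  simp only [toTensor, map_sum, map_smul, toMatHom_tmul, Matrix.sum_apply, Matrix.smul_apply,
    Matrix.vecMulVec_apply, smul_eq_mul]
  fin_cases i <;> fin_cases j <;> simp [Fin.sum_univ_two, Fin.sum_univ_three]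

/-- The identification of `F² ⊗ F³` with the space of `2 × 3` matrices. -/
def toMat : V F ≃ₗ[F] Mat F :=
  LinearEquiv.ofLinearMap toMatHom toTensorHom
    (LinearMap.ext toMatHom_toTensor)
    (by
      ext i j
      simp [toTensorHom, toTensor, Fin.sum_univ_two, Fin.sum_univ_three, Matrix.vecMulVec_apply]
      fin_cases i <;> fin_cases j <;> simp)

@[simp] lemma toMat_tmul (a : Fin 2 → F) (b : Fin 3 → F) :
    toMat (a ⊗ₜ[F] b) = Matrix.vecMulVec a b := rfl

@[simp] lemma toMat_toTensor (M : Mat F) : toMat (toTensor M) = M := toMatHom_toTensor M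

/-! ### The action on matrices -/

/-- The map `M ↦ P M Q`. -/
def act (P : Matrix (Fin 2) (Fin 2) F) (Q : Matrix (Fin 3) (Fin 3) F) : Mat F →ₗ[F] Mat F where
  toFun M := P * M * Q
  map_add' M N := by rw [Matrix.mul_add, Matrix.add_mul]
  map_smul' c M := by simp

@[simp] lemma act_apply (P : Matrix (Fin 2) (Fin 2) F) (Q : Matrix (Fin 3) (Fin 3) F)
    (M : Mat F) : act P Q M = P * M * Q := rfl

lemma act_comp (P P' : Matrix (Fin 2) (Fin 2) F) (Q Q' : Matrix (Fin 3) (Fin 3) F) :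
    act P Q ∘ₗ act P' Q' = act (P * P') (Q' * Q) := by
  ext1 M; simp [Matrix.mul_assoc]

lemma act_one : act (1 : Matrix (Fin 2) (Fin 2) F) 1 = LinearMap.id := by
  ext1 M; simp

lemma map_act_act (P P' : Matrix (Fin 2) (Fin 2) F) (Q Q' : Matrix (Fin 3) (Fin 3) F)
    (W : Submodule F (Mat F)) :
    (W.map (act P' Q')).map (act P Q) = W.map (act (P * P') (Q' * Q)) := by
  rw [← act_comp, Submodule.map_comp]

/-- Equivalence of spaces of `2 × 3` matrices. -/
def MatEquiv (W W' : Submodule F (Mat F)) : Prop :=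
  ∃ (P : Matrix (Fin 2) (Fin 2) F) (Q : Matrix (Fin 3) (Fin 3) F),
    P.det ≠ 0 ∧ Q.det ≠ 0 ∧ W' = W.map (act P Q)

lemma MatEquiv.refl (W : Submodule F (Mat F)) : MatEquiv W W :=
  ⟨1, 1, by simp, by simp, by rw [act_one, Submodule.map_id]⟩

lemma MatEquiv.trans {W W' W'' : Submodule F (Mat F)} (h : MatEquiv W W')
    (h' : MatEquiv W' W'') : MatEquiv W W'' := by
  obtain ⟨P, Q, hP, hQ, rfl⟩ := h
  obtain ⟨P', Q', hP', hQ', rfl⟩ := h'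
  exact ⟨P' * P, Q * Q', by simp [*], by simp [*], map_act_act _ _ _ _ _⟩

lemma map_act_inv {P : Matrix (Fin 2) (Fin 2) F} {Q : Matrix (Fin 3) (Fin 3) F}
    (hP : P.det ≠ 0) (hQ : Q.det ≠ 0) (W : Submodule F (Mat F)) :
    (W.map (act P Q)).map (act P⁻¹ Q⁻¹) = W := by
  rw [map_act_act, Matrix.nonsing_inv_mul _ hP.isUnit, Matrix.mul_nonsing_inv _ hQ.isUnit, act_one,
    Submodule.map_id]

lemma det_inv_ne_zero {n : ℕ} {P : Matrix (Fin n) (Fin n) F} (hP : P.det ≠ 0) :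
    P⁻¹.det ≠ 0 := by
  rw [Matrix.det_nonsing_inv]; simpa using hP

lemma MatEquiv.symm {W W' : Submodule F (Mat F)} (h : MatEquiv W W') : MatEquiv W' W := by
  obtain ⟨P, Q, hP, hQ, rfl⟩ := h
  exact ⟨P⁻¹, Q⁻¹, det_inv_ne_zero hP, det_inv_ne_zero hQ, (map_act_inv hP hQ W).symm⟩

/-- A pure tensor a ⊗ b is the matrix abᵀ, and (Pa)(Rb)ᵀ = P(abᵀ)Rᵀ. This is why the second factor
acts on the right through a transpose. -/
lemma toMat_congr (g : (Fin 2 → F) ≃ₗ[F] (Fin 2 → F)) (h : (Fin 3 → F) ≃ₗ[F] (Fin 3 → F))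
    (t : V F) : toMat (TensorProduct.congr g h t) =
      act (LinearMap.toMatrix' g.toLinearMap) (LinearMap.toMatrix' h.toLinearMap).transpose
        (toMat t) := by
  induction t using TensorProduct.induction_on with
  | zero => simp
  | add x y hx hy => simp only [map_add, hx, hy]
  | tmul a b =>
    simp [Matrix.mul_vecMulVec, Matrix.vecMulVec_mul, Matrix.vecMul_transpose]

lemma map_toMat_congr (g : (Fin 2 → F) ≃ₗ[F] (Fin 2 → F)) (h : (Fin 3 → F) ≃ₗ[F] (Fin 3 → F))
    (U : Submodule F (V F)) :
    (U.map (TensorProduct.congr g h).toLinearMap).map toMat.toLinearMap =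
      (U.map toMat.toLinearMap).map (act (LinearMap.toMatrix' g.toLinearMap)
        (LinearMap.toMatrix' h.toLinearMap).transpose) := by
  rw [← Submodule.map_comp, ← Submodule.map_comp]
  congr 1
  exact LinearMap.ext (toMat_congr g h)

lemma det_toMatrix_equiv {n : ℕ} (g : (Fin n → F) ≃ₗ[F] (Fin n → F)) :
    (LinearMap.toMatrix' g.toLinearMap).det ≠ 0 := by
  rw [LinearMap.det_toMatrix']
  exact (LinearEquiv.isUnit_det' g).ne_zero

lemma exists_equiv_toMatrix {n : ℕ} {P : Matrix (Fin n) (Fin n) F} (hP : P.det ≠ 0) :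
    ∃ g : (Fin n → F) ≃ₗ[F] (Fin n → F), LinearMap.toMatrix' g.toLinearMap = P :=
  ⟨Matrix.toLinearEquiv' P (P.invertibleOfIsUnitDet hP.isUnit), by
    rw [Matrix.toLinearEquiv'_apply, LinearMap.toMatrix'_toLin']⟩

lemma map_toMat_injective :
    Function.Injective (Submodule.map (toMat (F := F)).toLinearMap) :=
  Submodule.map_injective_of_injective toMat.injective

lemma mem_subspaceOrbit_iff {U W : Submodule F (V F)} :
    W ∈ subspaceOrbit U ↔
      MatEquiv (U.map toMat.toLinearMap) (W.map toMat.toLinearMap) := by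
  constructor
  · rintro ⟨g, h, rfl⟩
    exact ⟨_, _, det_toMatrix_equiv g, by simpa using det_toMatrix_equiv h,
      map_toMat_congr g h U⟩
  · rintro ⟨P, Q, hP, hQ, e⟩
    obtain ⟨g, rfl⟩ := exists_equiv_toMatrix hP
    obtain ⟨h, hh⟩ := exists_equiv_toMatrix (P := Q.transpose) (by simpa using hQ)
    refine ⟨g, h, map_toMat_injective ?_⟩
    rw [e, map_toMat_congr, hh, Matrix.transpose_transpose]

/-! ### Duality -/

/-- The bilinear form `∑ Nᵢⱼ Mᵢⱼ` on matrices. -/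
def matForm : LinearMap.BilinForm F (Mat F) :=
  LinearMap.mk₂ F (fun N M => (N.transpose * M).trace)
    (fun _ _ _ => by simp [Matrix.add_mul]) (fun _ _ _ => by simp)
    (fun _ _ _ => by simp [Matrix.mul_add]) (fun _ _ _ => by simp)

lemma matForm_apply (N M : Mat F) : matForm N M = (N.transpose * M).trace := rfl

lemma matForm_eq (N M : Mat F) : matForm N M =
    N 0 0 * M 0 0 + N 0 1 * M 0 1 + N 0 2 * M 0 2 +
      (N 1 0 * M 1 0 + N 1 1 * M 1 1 + N 1 2 * M 1 2) := by
  simp [matForm_apply, Matrix.trace, Matrix.mul_apply, Fin.sum_univ_two, Fin.sum_univ_three]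
  ring

lemma matForm_isRefl : (matForm (F := F)).IsRefl := by
  intro N M h
  rw [matForm_eq] at h ⊢
  rw [← h]; ring

lemma matForm_nondegenerate : (matForm (F := F)).Nondegenerate := by
  refine ⟨fun N h => ?_, fun N h => ?_⟩ <;> ext i j <;>
    have := h (Matrix.single i j 1) <;> rw [matForm_eq] at this <;>
    fin_cases i <;> fin_cases j <;> simpa using this

/-- Cyclicity of the trace. -/
lemma matForm_act (P : Matrix (Fin 2) (Fin 2) F) (Q : Matrix (Fin 3) (Fin 3) F) (N M : Mat F) :
    matForm (act P Q N) M = matForm N (act P.transpose Q.transpose M) := by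
  simp only [matForm_apply, act_apply, Matrix.transpose_mul, Matrix.mul_assoc]
  rw [Matrix.trace_mul_comm]
  simp only [Matrix.mul_assoc]

/-- The orthogonal space of a space of matrices. -/
def mperp (W : Submodule F (Mat F)) : Submodule F (Mat F) :=
  LinearMap.BilinForm.orthogonal matForm W

lemma mem_mperp_span {s : Set (Mat F)} {M : Mat F} :
    M ∈ mperp (Submodule.span F s) ↔ ∀ N ∈ s, matForm N M = 0 := by
  refine ⟨fun h N hN => h N (Submodule.subset_span hN), fun h N hN => ?_⟩
  change matForm N M = 0
  induction hN using Submodule.span_induction with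
  | mem x hx => exact h x hx
  | zero => simp
  | add x y _ _ hx hy => simp [hx, hy]
  | smul c x _ hx => simp [hx]

@[simp] lemma mperp_mperp (W : Submodule F (Mat F)) : mperp (mperp W) = W :=
  LinearMap.BilinForm.orthogonal_orthogonal matForm_nondegenerate matForm_isRefl W

lemma finrank_mperp (W : Submodule F (Mat F)) :
    Module.finrank F (mperp W) = 6 - Module.finrank F W := by
  rw [mperp, LinearMap.BilinForm.finrank_orthogonal matForm_nondegenerate, Module.finrank_matrix]
  simp

/-- By the adjoint formula `matForm_act`, orthogonal spaces transform contragrediently. Inverse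
transposes of invertible matrices are invertible, so equivalence passes to orthogonal spaces. -/
lemma mperp_map_act {P : Matrix (Fin 2) (Fin 2) F} {Q : Matrix (Fin 3) (Fin 3) F}
    (hP : P.det ≠ 0) (hQ : Q.det ≠ 0) (W : Submodule F (Mat F)) :
    mperp (W.map (act P Q)) = (mperp W).map (act P.transpose⁻¹ Q.transpose⁻¹) := by
  have hP' : P.transpose.det ≠ 0 := by simpa using hP
  have hQ' : Q.transpose.det ≠ 0 := by simpa using hQ
  ext M
  constructor
  · intro h
    refine ⟨act P.transpose Q.transpose M, fun N hN => ?_, ?_⟩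
    · exact (matForm_act P Q N M).symm.trans (h _ (Submodule.mem_map_of_mem hN))
    · rw [← LinearMap.comp_apply, act_comp, Matrix.nonsing_inv_mul _ hP'.isUnit,
        Matrix.mul_nonsing_inv _ hQ'.isUnit, act_one, LinearMap.id_apply]
  · rintro ⟨M, hM, rfl⟩ _ ⟨N, hN, rfl⟩
    change matForm _ _ = 0
    have e : act P.transpose Q.transpose (act P.transpose⁻¹ Q.transpose⁻¹ M) = M := by
      rw [← LinearMap.comp_apply, act_comp, Matrix.mul_nonsing_inv _ hP'.isUnit,
        Matrix.nonsing_inv_mul _ hQ'.isUnit, act_one, LinearMap.id_apply]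
    rw [matForm_act, e]
    exact hM N hN

lemma MatEquiv.mperp {W W' : Submodule F (Mat F)} (h : MatEquiv W W') :
    MatEquiv (mperp W) (mperp W') := by
  obtain ⟨P, Q, hP, hQ, rfl⟩ := h
  exact ⟨_, _, det_inv_ne_zero (by simpa using hP), det_inv_ne_zero (by simpa using hQ),
    mperp_map_act hP hQ W⟩

/-- The space of equations of a subspace of `F² ⊗ F³`. -/
def dualOf (U : Submodule F (V F)) : Submodule F (Mat F) := mperp (U.map toMat.toLinearMap)

/-- This reduces four- and five-dimensional subspaces to two- and one-dimensional ones. The converse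
direction applies the orthogonal space a second time. -/
lemma mem_subspaceOrbit_iff_dualOf {U W : Submodule F (V F)} :
    W ∈ subspaceOrbit U ↔ MatEquiv (dualOf U) (dualOf W) := by
  rw [mem_subspaceOrbit_iff]
  refine ⟨fun h => h.mperp, fun h => ?_⟩
  simpa [dualOf] using h.mperp

lemma finrank_dualOf (U : Submodule F (V F)) :
    Module.finrank F (dualOf U) = 6 - Module.finrank F U := by
  rw [dualOf, finrank_mperp, LinearEquiv.finrank_map_eq toMat U]

/-- The subspace of `F² ⊗ F³` with a given space of equations. -/
def solutions (W : Submodule F (Mat F)) : Submodule F (V F) :=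
  (mperp W).comap toMat.toLinearMap

lemma mem_solutions {W : Submodule F (Mat F)} {t : V F} :
    t ∈ solutions W ↔ toMat t ∈ mperp W := Iff.rfl

lemma map_toMat_solutions (W : Submodule F (Mat F)) :
    (solutions W).map toMat.toLinearMap = mperp W :=
  Submodule.map_comap_eq_of_surjective toMat.surjective _

@[simp] lemma dualOf_solutions (W : Submodule F (Mat F)) : dualOf (solutions W) = W := by
  rw [dualOf, map_toMat_solutions, mperp_mperp]

lemma finrank_solutions (W : Submodule F (Mat F)) :
    Module.finrank F (solutions W) = 6 - Module.finrank F W := by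
  rw [← LinearEquiv.finrank_map_eq toMat (solutions W), ← finrank_mperp]
  exact congrArg (fun X : Submodule F (Mat F) => Module.finrank F X) (map_toMat_solutions W)

/-! ### Perps of contraction spaces -/

/-- With Gram matrices B₁ and B₂, the product of aᵀB₁c and bᵀB₂d is the trace pairing of
(B₁ᵀa)(bᵀB₂) with cdᵀ. Bilinearity extends this from pure tensors. -/
lemma tmul_form_eq (β₁ : LinearMap.BilinForm F (Fin 2 → F)) (β₂ : LinearMap.BilinForm F (Fin 3 → F))
    (s t : V F) :
    LinearMap.BilinForm.tmul β₁ β₂ s t =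
      matForm (act (LinearMap.BilinForm.toMatrix' β₁).transpose
        (LinearMap.BilinForm.toMatrix' β₂) (toMat s)) (toMat t) := by
  induction s using TensorProduct.induction_on with
  | zero => simp
  | add x y hx hy => simp only [map_add, LinearMap.add_apply, hx, hy]
  | tmul a b =>
    induction t using TensorProduct.induction_on with
    | zero => simp
    | add x y hx hy => simp only [map_add, hx, hy]
    | tmul c d =>
      have h1 : β₁ a c = dotProduct a (LinearMap.BilinForm.toMatrix' β₁ |>.mulVec c) := by
        rw [← Matrix.toBilin'_apply', Matrix.toBilin'_toMatrix']
      have h2 : β₂ b d = dotProduct b (LinearMap.BilinForm.toMatrix' β₂ |>.mulVec d) := by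
        rw [← Matrix.toBilin'_apply', Matrix.toBilin'_toMatrix']
      simp only [LinearMap.BilinForm.tmul, LinearMap.BilinForm.tensorDistrib_tmul, h1, h2,
        toMat_tmul, act_apply, Matrix.mul_vecMulVec, Matrix.vecMulVec_mul, matForm_apply,
        Matrix.transpose_vecMulVec, Matrix.trace_vecMulVec, Matrix.mulVec_transpose,
        Matrix.dotProduct_mulVec]
      rw [Matrix.vecMulVec_mulVec]
      simp [mul_comm]

lemma map_toMat_perp (β₁ : LinearMap.BilinForm F (Fin 2 → F))
    (β₂ : LinearMap.BilinForm F (Fin 3 → F)) (U : Submodule F (V F)) :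
    (perp β₁ β₂ U).map toMat.toLinearMap =
      mperp ((U.map toMat.toLinearMap).map (act (LinearMap.BilinForm.toMatrix' β₁).transpose
        (LinearMap.BilinForm.toMatrix' β₂))) := by
  ext M
  constructor
  · rintro ⟨t, ht, rfl⟩ _ ⟨_, ⟨s, hs, rfl⟩, rfl⟩
    exact (tmul_form_eq β₁ β₂ s t).symm.trans (ht s hs)
  · intro h
    refine ⟨toMat.symm M, fun s hs => ?_, by simp⟩
    have := h _ (Submodule.mem_map_of_mem (Submodule.mem_map_of_mem hs))
    refine (tmul_form_eq β₁ β₂ s _).trans ?_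
    simpa using this

/-- Nondegeneracy makes the Gram matrices invertible, so they are an admissible pair of row and
column operations. The choice of β disappears here. -/
lemma dualOf_perp {β₁ : LinearMap.BilinForm F (Fin 2 → F)}
    {β₂ : LinearMap.BilinForm F (Fin 3 → F)} (h₁ : β₁.Nondegenerate) (h₂ : β₂.Nondegenerate)
    (U : Submodule F (V F)) :
    MatEquiv (U.map toMat.toLinearMap) (dualOf (perp β₁ β₂ U)) := by
  refine ⟨_, _, ?_, ?_, by rw [dualOf, map_toMat_perp, mperp_mperp]⟩
  · rw [Matrix.det_transpose]
    exact (LinearMap.BilinForm.nondegenerate_iff_det_ne_zero (Pi.basisFun F (Fin 2))).1 h₁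
  · exact (LinearMap.BilinForm.nondegenerate_iff_det_ne_zero (Pi.basisFun F (Fin 3))).1 h₂

lemma contract2_congr (g : (Fin 2 → F) ≃ₗ[F] (Fin 2 → F)) (h k : (Fin 3 → F) ≃ₗ[F] (Fin 3 → F))
    (φ : Module.Dual F (Fin 3 → F)) (A : T3 F) :
    contract2 φ (TensorProduct.congr g (TensorProduct.congr h k) A) =
      TensorProduct.congr g k (contract2 (φ ∘ₗ h.toLinearMap) A) := by
  suffices e : contract2 φ ∘ₗ (TensorProduct.congr g (TensorProduct.congr h k)).toLinearMap =
      (TensorProduct.congr g k).toLinearMap ∘ₗ contract2 (φ ∘ₗ h.toLinearMap) from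
    LinearMap.congr_fun e A
  refine TensorProduct.ext_threefold' fun a b c => ?_
  simp [contract2]

/-- The automorphism h of the contracted factor only permutes the functionals φ, so g and k alone
act on the contraction space. -/
lemma contractionSpace2_congr (g : (Fin 2 → F) ≃ₗ[F] (Fin 2 → F))
    (h k : (Fin 3 → F) ≃ₗ[F] (Fin 3 → F)) (A : T3 F) :
    contractionSpace2 (TensorProduct.congr g (TensorProduct.congr h k) A) =
      (contractionSpace2 A).map (TensorProduct.congr g k).toLinearMap := by
  rw [contractionSpace2, contractionSpace2, Submodule.map_span, ← Set.range_comp]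
  congr 1
  ext t
  constructor
  · rintro ⟨φ, rfl⟩
    exact ⟨φ ∘ₗ h.toLinearMap, (contract2_congr g h k φ A).symm⟩
  · rintro ⟨φ, rfl⟩
    refine ⟨φ ∘ₗ h.symm.toLinearMap, ?_⟩
    simp only [contract2_congr, LinearMap.comp_assoc]
    simp [TensorProduct.congr]

/-! ### Contraction spaces of the canonical forms. -/

/-- The second contraction spaces of the canonical forms, as spaces of matrices. -/
def pencil (F : Type u) [Field F] : Label → Set (Submodule F (Mat F))
  | .o1 => {Submodule.span F {!![1, 0, 0; 0, 0, 0]}}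
  | .o2 => {Submodule.span F {!![1, 0, 0; 0, 0, 0], !![0, 1, 0; 0, 0, 0]}}
  | .o4 => {Submodule.span F {!![1, 0, 0; 0, 1, 0]}}
  | .o4T => {Submodule.span F {!![1, 0, 0; 0, 0, 0], !![0, 0, 0; 1, 0, 0]}}
  | .o5 => {Submodule.span F {!![1, 0, 0; 0, 0, 0], !![0, 0, 0; 0, 1, 0]}}
  | .o6 => {Submodule.span F {!![1, 0, 0; 0, 1, 0], !![0, 0, 0; 1, 0, 0]}}
  | .o7 => {Submodule.span F {!![0, 0, 1; 1, 0, 0], !![0, 0, 0; 0, 1, 0]}}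
  | .o10 => {C | ∃ u v : F, NoRoot u v ∧
      C = Submodule.span F {!![1, u, 0; 0, 1, 0], !![0, 1, 0; v, 0, 0]}}
  | .o11 => {Submodule.span F {!![1, 0, 0; 0, 1, 0], !![0, 1, 0; 0, 0, 1]}}

lemma contract2_e3 (φ : Module.Dual F (Fin 3 → F)) (i : Fin 2) (j k : Fin 3) :
    toMat (contract2 φ (e3 F i j k)) = φ (Pi.single j 1) • Matrix.single i k 1 := by
  simp [contract2, e3, Matrix.single_eq_single_vecMulVec_single]

lemma transposeTensor_e3 (i : Fin 2) (j k : Fin 3) :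
    transposeTensor (e3 F i j k) = e3 F i k j := by
  simp [transposeTensor, e3]

/-- A contraction depends only on the values of φ at the basis vectors, and the coordinate
functionals recover the individual slices N j. -/
lemma map_toMat_contractionSpace2 {A : T3 F} {N : Fin 3 → Mat F}
    (h : ∀ φ, toMat (contract2 φ A) = ∑ j, φ (Pi.single j 1) • N j) :
    (contractionSpace2 A).map toMat.toLinearMap = Submodule.span F (Set.range N) := by
  rw [contractionSpace2, Submodule.map_span, ← Set.range_comp]
  refine le_antisymm (Submodule.span_le.2 ?_) (Submodule.span_mono ?_)
  · rintro _ ⟨φ, rfl⟩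
    simp only [Function.comp_apply, LinearEquiv.coe_coe, h]
    exact Submodule.sum_mem _ fun j _ =>
      Submodule.smul_mem _ _ (Submodule.subset_span ⟨j, rfl⟩)
  · rintro _ ⟨j, rfl⟩
    refine ⟨LinearMap.proj j, ?_⟩
    simp [h, Pi.single_apply]

lemma map_toMat_contractionSpace2_pair {A : T3 F} {N₁ N₂ : Mat F}
    (h : ∀ φ, toMat (contract2 φ A) = φ (Pi.single 0 1) • N₁ + φ (Pi.single 1 1) • N₂) :
    (contractionSpace2 A).map toMat.toLinearMap = Submodule.span F {N₁, N₂} := by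
  rw [map_toMat_contractionSpace2 (N := ![N₁, N₂, 0]) fun φ => by
    rw [h]; simp [Fin.sum_univ_three]]
  simp [Matrix.range_cons, Submodule.span_insert, sup_comm]

lemma exists_canonicalForms_iff (l : Label) (W : Submodule F (Mat F)) :
    (∃ A ∈ canonicalForms F l, (contractionSpace2 A).map toMat.toLinearMap = W) ↔
      W ∈ pencil F l := by
  have single : ∀ (A : T3 F) (C : Submodule F (Mat F)),
      (contractionSpace2 A).map toMat.toLinearMap = C →
      ((∃ A' ∈ ({A} : Set (T3 F)), (contractionSpace2 A').map toMat.toLinearMap = W) ↔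
        W ∈ ({C} : Set (Submodule F (Mat F)))) := by
    rintro A C rfl
    simp [eq_comm]
  -- The forms o1 and o4 have only one nonzero slice; with 0 as a second generator they fall under
  -- the lemma for pairs.
  have pair0 : ∀ N : Mat F, Submodule.span F {N} = Submodule.span F {N, 0} := by
    intro N; simp [Submodule.span_insert]
  cases l
  case o10 =>
    have key : ∀ u v : F, (contractionSpace2 ((e3 F 0 0 0 + e3 F 0 1 1 + u • e3 F 0 0 1) +
        (e3 F 1 0 1 + v • e3 F 1 1 0))).map toMat.toLinearMap =
        Submodule.span F {!![1, u, 0; 0, 1, 0], !![0, 1, 0; v, 0, 0]} := by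
      intro u v
      refine map_toMat_contractionSpace2_pair fun φ => ?_
      simp only [map_add, map_smul, contract2_e3]
      ext i j
      fin_cases i <;> fin_cases j <;> simp [mul_comm, add_comm]
    constructor
    · rintro ⟨A, ⟨u, v, h, rfl⟩, rfl⟩
      exact ⟨u, v, h, key u v⟩
    · rintro ⟨u, v, h, rfl⟩
      exact ⟨_, ⟨u, v, h, rfl⟩, key u v⟩
  all_goals
    refine single _ _ ?_
    try rw [pair0]
    refine map_toMat_contractionSpace2_pair fun φ => ?_
    simp only [map_add, contract2_e3, transposeTensor_e3]
    ext i j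
    fin_cases i <;> fin_cases j <;> simp

/-- The right-hand side involves neither β nor tensors. What follows is about equivalence of matrix
spaces only. -/
lemma mem_perpOrbit_iff {β₁ : LinearMap.BilinForm F (Fin 2 → F)}
    {β₂ : LinearMap.BilinForm F (Fin 3 → F)} (h₁ : β₁.Nondegenerate) (h₂ : β₂.Nondegenerate)
    (l : Label) (U : Submodule F (V F)) :
    U ∈ perpOrbit β₁ β₂ l ↔ ∃ C ∈ pencil F l, MatEquiv C (dualOf U) := by
  constructor
  · rintro ⟨_, ⟨C, hC, g, h, k, rfl⟩, hU⟩
    refine ⟨_, (exists_canonicalForms_iff l _).1 ⟨C, hC, rfl⟩, ?_⟩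
    rw [mem_subspaceOrbit_iff_dualOf] at hU
    refine .trans (mem_subspaceOrbit_iff.1 ?_) ((dualOf_perp h₁ h₂ _).trans hU)
    exact ⟨g, k, contractionSpace2_congr g h k C⟩
  · rintro ⟨_, hC, hU⟩
    obtain ⟨A, hA, rfl⟩ := (exists_canonicalForms_iff l _).2 hC
    refine ⟨A, ⟨A, hA, .refl _ _, .refl _ _, .refl _ _, by simp [TensorProduct.congr]⟩, ?_⟩
    rw [mem_subspaceOrbit_iff_dualOf]
    exact (dualOf_perp h₁ h₂ _).symm.trans hU

/-! ### Normal forms of spaces of matrices of dimension one and two -/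

/-- Equivalence of `2 × 3` matrices. -/
def MatRel (M N : Mat F) : Prop :=
  ∃ (P : Matrix (Fin 2) (Fin 2) F) (Q : Matrix (Fin 3) (Fin 3) F),
    P.det ≠ 0 ∧ Q.det ≠ 0 ∧ N = P * M * Q

lemma MatRel.trans {M N L : Mat F} (h : MatRel M N) (h' : MatRel N L) : MatRel M L := by
  obtain ⟨P, Q, hP, hQ, rfl⟩ := h
  obtain ⟨P', Q', hP', hQ', rfl⟩ := h'
  exact ⟨P' * P, Q * Q', by simp [*], by simp [*], by simp only [Matrix.mul_assoc]⟩

lemma MatRel.span_singleton {M N : Mat F} (h : MatRel M N) :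
    MatEquiv (Submodule.span F {M}) (Submodule.span F {N}) := by
  obtain ⟨P, Q, hP, hQ, rfl⟩ := h
  exact ⟨P, Q, hP, hQ, by simp [Submodule.map_span]⟩

lemma MatRel.span_pair {M N : Mat F} (h : MatRel M N) (M' : Mat F) :
    ∃ N', MatEquiv (Submodule.span F {M, M'}) (Submodule.span F {N, N'}) := by
  obtain ⟨P, Q, hP, hQ, rfl⟩ := h
  exact ⟨P * M' * Q, P, Q, hP, hQ, by simp [Submodule.map_span, Set.image_pair]⟩

lemma span_pair_eq_of_det {E : Type*} [AddCommGroup E] [Module F E] (M₁ M₂ : E) {a b c d : F}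
    (h : a * d - b * c ≠ 0) :
    Submodule.span F {a • M₁ + b • M₂, c • M₁ + d • M₂} = Submodule.span F {M₁, M₂} := by
  apply le_antisymm
  · rw [Submodule.span_le, Set.insert_subset_iff, Set.singleton_subset_iff]
    exact ⟨Submodule.mem_span_pair.2 ⟨a, b, rfl⟩, Submodule.mem_span_pair.2 ⟨c, d, rfl⟩⟩
  · rw [Submodule.span_le, Set.insert_subset_iff, Set.singleton_subset_iff]
    refine ⟨Submodule.mem_span_pair.2 ⟨d / (a * d - b * c), -b / (a * d - b * c), ?_⟩,
      Submodule.mem_span_pair.2 ⟨-c / (a * d - b * c), a / (a * d - b * c), ?_⟩⟩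
    -- Writing the coefficient 1 as det / det turns Cramer's rule into an identity of linear
    -- combinations that `module` can check.
    · have e : M₁ = ((a * d - b * c) / (a * d - b * c)) • M₁ := by rw [div_self h, one_smul]
      conv_rhs => rw [e]
      module
    · have e : M₂ = ((a * d - b * c) / (a * d - b * c)) • M₂ := by rw [div_self h, one_smul]
      conv_rhs => rw [e]
      module

/-- The format of the explicit reductions of pencils below: P and Q are row and column operations,
and a, b, c, d change the basis of the pencil. Each use amounts to checking two matrix identities.
-/
lemma matEquiv_span_pair (P : Matrix (Fin 2) (Fin 2) F) (Q : Matrix (Fin 3) (Fin 3) F)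
    (a b c d : F) {M₁ M₂ N₁ N₂ : Mat F} (hP : P.det ≠ 0) (hQ : Q.det ≠ 0)
    (h : a * d - b * c ≠ 0) (h₁ : N₁ = a • (P * M₁ * Q) + b • (P * M₂ * Q))
    (h₂ : N₂ = c • (P * M₁ * Q) + d • (P * M₂ * Q)) :
    MatEquiv (Submodule.span F {M₁, M₂}) (Submodule.span F {N₁, N₂}) := by
  refine ⟨P, Q, hP, hQ, ?_⟩
  rw [h₁, h₂, span_pair_eq_of_det _ _ h]
  simp [Submodule.map_span, Set.image_pair]

/-- The row (e, f) is carried to (1, 0) by the invertible matrix with rows (p, q) and (r, s). -/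
lemma exists_pair_transform {e f : F} (h : e ≠ 0 ∨ f ≠ 0) :
    ∃ p q r s : F, p * s - q * r ≠ 0 ∧ e * p + f * r = 1 ∧ e * q + f * s = 0 := by
  by_cases he : e = 0
  · have hf : f ≠ 0 := by simpa [he] using h
    exact ⟨0, 1, f⁻¹, 0, by simpa using hf, by simp [hf], by simp [he]⟩
  · exact ⟨e⁻¹, -f * e⁻¹, 0, 1, by simpa using he, by simp [he], by field_simp; ring⟩

lemma exists_mulVec_eq {a : Fin 2 → F} (ha : a ≠ 0) :
    ∃ P : Matrix (Fin 2) (Fin 2) F, P.det ≠ 0 ∧ P.mulVec a = ![1, 0] := by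
  have : a 0 ≠ 0 ∨ a 1 ≠ 0 := by
    by_contra! h
    exact ha (funext fun i => by fin_cases i <;> simp [h])
  obtain ⟨p, q, r, s, hd, h1, h2⟩ := exists_pair_transform this
  refine ⟨!![p, r; q, s], by rw [Matrix.det_fin_two_of]; convert hd using 1; ring, ?_⟩
  ext i
  fin_cases i
  · simpa [Matrix.mulVec, dotProduct, Fin.sum_univ_two, mul_comm] using h1
  · simpa [Matrix.mulVec, dotProduct, Fin.sum_univ_two, mul_comm] using h2

lemma exists_vecMul_eq {b : Fin 3 → F} (hb : b ≠ 0) :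
    ∃ Q : Matrix (Fin 3) (Fin 3) F, Q.det ≠ 0 ∧ Matrix.vecMul b Q = ![1, 0, 0] := by
  by_cases h0 : b 0 = 0
  · by_cases h1 : b 1 = 0
    · have h2 : b 2 ≠ 0 := fun h2 => hb (funext fun i => by fin_cases i <;> simp [*])
      refine ⟨!![0, 0, 1; 0, 1, 0; (b 2)⁻¹, 0, 0], by simp [Matrix.det_fin_three, h2], ?_⟩
      ext i
      fin_cases i <;> simp [Matrix.vecMul, dotProduct, Fin.sum_univ_three, h0, h1, h2]
    · refine ⟨!![0, 1, 0; (b 1)⁻¹, 0, -b 2 * (b 1)⁻¹; 0, 0, 1],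
        by simp [Matrix.det_fin_three, h1], ?_⟩
      ext i
      fin_cases i <;> simp [Matrix.vecMul, dotProduct, Fin.sum_univ_three, h0, h1]
      field_simp; ring
  · refine ⟨!![(b 0)⁻¹, -b 1 * (b 0)⁻¹, -b 2 * (b 0)⁻¹; 0, 1, 0; 0, 0, 1],
      by simp [Matrix.det_fin_three, h0], ?_⟩
    ext i
    fin_cases i <;> simp [Matrix.vecMul, dotProduct, Fin.sum_univ_three, h0] <;>
      field_simp <;> ring

lemma matRel_vecMulVec {a : Fin 2 → F} {b : Fin 3 → F} (ha : a ≠ 0) (hb : b ≠ 0) :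
    MatRel (Matrix.vecMulVec a b) !![1, 0, 0; 0, 0, 0] := by
  obtain ⟨P, hP, hPa⟩ := exists_mulVec_eq ha
  obtain ⟨Q, hQ, hQb⟩ := exists_vecMul_eq hb
  refine ⟨P, Q, hP, hQ, ?_⟩
  rw [Matrix.mul_vecMulVec, Matrix.vecMulVec_mul, hPa, hQb]
  ext i j
  fin_cases i <;> fin_cases j <;> simp [Matrix.vecMulVec_apply]

/-- A swap of rows makes the first row nonzero, and column operations make it (1, 0, 0). After the
entry below the pivot is cleared, the rest of the second row is either zero or can be carried to (1,
0). -/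
lemma matRel_canonical {N : Mat F} (hN : N ≠ 0) :
    MatRel N !![1, 0, 0; 0, 0, 0] ∨ MatRel N !![1, 0, 0; 0, 1, 0] := by
  obtain ⟨N', hN', hr⟩ : ∃ N', MatRel N N' ∧ N' 0 ≠ 0 := by
    by_cases h : N 0 = 0
    · refine ⟨_, ⟨!![0, 1; 1, 0], 1, by simp, by simp, rfl⟩, fun h' => hN ?_⟩
      ext i j
      fin_cases i
      · exact congrFun h j
      · rw [Matrix.mul_one] at h'
        simpa [Matrix.mul_apply, Fin.sum_univ_two] using congrFun h' j
    · exact ⟨N, ⟨1, 1, by simp, by simp, by simp⟩, h⟩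
  obtain ⟨Q, hQ, hQb⟩ := exists_vecMul_eq hr
  have e0 : ∀ j, (N' * Q) 0 j = ![1, 0, 0] j := fun j => by
    rw [← hQb]; rfl
  have hrel : MatRel N (N' * Q) := hN'.trans ⟨1, Q, by simp, hQ, by simp⟩
  generalize N' * Q = L at e0 hrel
  have hL : L = !![1, 0, 0; L 1 0, L 1 1, L 1 2] := by
    ext i j
    fin_cases i <;> fin_cases j <;> simp [e0]
  generalize L 1 0 = d at hL
  generalize L 1 1 = e at hL
  generalize L 1 2 = f at hL
  subst hL
  by_cases h : e ≠ 0 ∨ f ≠ 0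
  · right
    obtain ⟨p, q, r, s, hd, h1, h2⟩ := exists_pair_transform h
    refine hrel.trans ⟨!![1, 0; -d, 1], !![1, 0, 0; 0, p, q; 0, r, s], by simp,
      by simpa [Matrix.det_fin_three] using hd, ?_⟩
    ext i j
    fin_cases i <;> fin_cases j <;> 
      simp [Matrix.mul_apply, Fin.sum_univ_three, h1, h2]
  · left
    push Not at h
    refine hrel.trans ⟨!![1, 0; -d, 1], 1, by simp, by simp, ?_⟩
    rw [Matrix.mul_one]
    ext i j
    fin_cases i <;> fin_cases j <;> simp [h]

/-- The matrices of rank at most one. -/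
def RankLeOne (M : Mat F) : Prop := ∃ a b, M = Matrix.vecMulVec a b

lemma RankLeOne.act {M : Mat F} (h : RankLeOne M) (P : Matrix (Fin 2) (Fin 2) F)
    (Q : Matrix (Fin 3) (Fin 3) F) : RankLeOne (act P Q M) := by
  obtain ⟨a, b, rfl⟩ := h
  exact ⟨P.mulVec a, Matrix.vecMul b Q, by
    rw [act_apply, Matrix.mul_vecMulVec, Matrix.vecMulVec_mul]⟩

/-- The usual obstruction to rank one below: a member of a pencil has rank two once one of its 2 × 2
minors is nonzero. -/
lemma RankLeOne.minor {M : Mat F} (h : RankLeOne M) (j k : Fin 3) :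
    M 0 j * M 1 k = M 0 k * M 1 j := by
  obtain ⟨a, b, rfl⟩ := h
  simp only [Matrix.vecMulVec_apply]; ring

lemma act_inv_act {P : Matrix (Fin 2) (Fin 2) F} {Q : Matrix (Fin 3) (Fin 3) F}
    (hP : P.det ≠ 0) (hQ : Q.det ≠ 0) (M : Mat F) : act P⁻¹ Q⁻¹ (act P Q M) = M := by
  rw [← LinearMap.comp_apply, act_comp, Matrix.nonsing_inv_mul _ hP.isUnit,
    Matrix.mul_nonsing_inv _ hQ.isUnit, act_one, LinearMap.id_apply]

lemma act_eq_zero {P : Matrix (Fin 2) (Fin 2) F} {Q : Matrix (Fin 3) (Fin 3) F}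
    (hP : P.det ≠ 0) (hQ : Q.det ≠ 0) {M : Mat F} (h : act P Q M = 0) : M = 0 := by
  rw [← act_inv_act hP hQ M, h, map_zero]

lemma rankLeOne_act_iff {P : Matrix (Fin 2) (Fin 2) F} {Q : Matrix (Fin 3) (Fin 3) F}
    (hP : P.det ≠ 0) (hQ : Q.det ≠ 0) {M : Mat F} : RankLeOne (act P Q M) ↔ RankLeOne M :=
  ⟨fun h => by simpa only [act_inv_act hP hQ] using h.act P⁻¹ Q⁻¹, fun h => h.act P Q⟩

/-! ### Invariants -/

/-- Some nonzero vector annihilates all members from the left. -/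
def HasLeftKernel (W : Submodule F (Mat F)) : Prop :=
  ∃ a : Fin 2 → F, a ≠ 0 ∧ ∀ M ∈ W, Matrix.vecMul a M = 0

/-- Some nonzero vector is annihilated by all members. -/
def HasRightKernel (W : Submodule F (Mat F)) : Prop :=
  ∃ b : Fin 3 → F, b ≠ 0 ∧ ∀ M ∈ W, Matrix.mulVec M b = 0

/-- Some member has rank one. -/
def HasRankOne (W : Submodule F (Mat F)) : Prop := ∃ M ∈ W, M ≠ 0 ∧ RankLeOne M

/-- No member has rank two. -/
def AllRankLeOne (W : Submodule F (Mat F)) : Prop := ∀ M ∈ W, RankLeOne M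

/-- Some sum of two members of rank at most one has rank two. -/
def HasRankTwoSum (W : Submodule F (Mat F)) : Prop :=
  ∃ M ∈ W, ∃ N ∈ W, RankLeOne M ∧ RankLeOne N ∧ ¬ RankLeOne (M + N)

lemma HasLeftKernel.matEquiv {W W' : Submodule F (Mat F)} (hW : HasLeftKernel W)
    (h : MatEquiv W W') : HasLeftKernel W' := by
  obtain ⟨P, Q, hP, hQ, rfl⟩ := h
  obtain ⟨a, ha, haW⟩ := hW
  refine ⟨Matrix.vecMul a P⁻¹, fun h0 => ha ?_, ?_⟩
  · have := congrArg (fun v => Matrix.vecMul v P) h0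
    simpa [Matrix.vecMul_vecMul, Matrix.nonsing_inv_mul _ hP.isUnit] using this
  · rintro _ ⟨M, hM, rfl⟩
    rw [act_apply, Matrix.mul_assoc, Matrix.vecMul_vecMul, ← Matrix.mul_assoc,
      Matrix.nonsing_inv_mul _ hP.isUnit, Matrix.one_mul, ← Matrix.vecMul_vecMul, haW M hM,
      Matrix.zero_vecMul]

lemma HasRightKernel.matEquiv {W W' : Submodule F (Mat F)} (hW : HasRightKernel W)
    (h : MatEquiv W W') : HasRightKernel W' := by
  obtain ⟨P, Q, hP, hQ, rfl⟩ := h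
  obtain ⟨b, hb, hbW⟩ := hW
  refine ⟨Q⁻¹.mulVec b, fun h0 => hb ?_, ?_⟩
  · have := congrArg (fun v => Q.mulVec v) h0
    simpa [Matrix.mulVec_mulVec, Matrix.mul_nonsing_inv _ hQ.isUnit] using this
  · rintro _ ⟨M, hM, rfl⟩
    rw [act_apply, Matrix.mulVec_mulVec, Matrix.mul_assoc, Matrix.mul_nonsing_inv _ hQ.isUnit,
      Matrix.mul_one, ← Matrix.mulVec_mulVec, hbW M hM, Matrix.mulVec_zero]

lemma HasRankOne.matEquiv {W W' : Submodule F (Mat F)} (hW : HasRankOne W)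
    (h : MatEquiv W W') : HasRankOne W' := by
  obtain ⟨P, Q, hP, hQ, rfl⟩ := h
  obtain ⟨M, hM, h0, h1⟩ := hW
  exact ⟨_, Submodule.mem_map_of_mem hM, fun h => h0 (act_eq_zero hP hQ h), h1.act P Q⟩

lemma AllRankLeOne.matEquiv {W W' : Submodule F (Mat F)} (hW : AllRankLeOne W)
    (h : MatEquiv W W') : AllRankLeOne W' := by
  obtain ⟨P, Q, hP, hQ, rfl⟩ := h
  rintro _ ⟨M, hM, rfl⟩
  exact (hW M hM).act P Q

lemma HasRankTwoSum.matEquiv {W W' : Submodule F (Mat F)} (hW : HasRankTwoSum W)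
    (h : MatEquiv W W') : HasRankTwoSum W' := by
  obtain ⟨P, Q, hP, hQ, rfl⟩ := h
  obtain ⟨M, hM, N, hN, h1, h2, h3⟩ := hW
  refine ⟨_, Submodule.mem_map_of_mem hM, _, Submodule.mem_map_of_mem hN, h1.act P Q, h2.act P Q,
    fun h => h3 ?_⟩
  rw [← map_add] at h
  exact (rankLeOne_act_iff hP hQ).1 h

lemma finrank_eq_of_matEquiv {W W' : Submodule F (Mat F)} (h : MatEquiv W W') :
    Module.finrank F W' = Module.finrank F W := by
  obtain ⟨P, Q, hP, hQ, rfl⟩ := h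
  exact (Submodule.equivMapOfInjective (act P Q)
    ((injective_iff_map_eq_zero _).2 fun M => act_eq_zero hP hQ) W).finrank_eq.symm

/-- A property of spaces of matrices that is invariant under equivalence and characterizes the
members of `pencil F l`. -/
def Trait : Label → Submodule F (Mat F) → Prop
  | .o1, W => Module.finrank F W = 1 ∧ HasRankOne W
  | .o4, W => Module.finrank F W = 1 ∧ ¬ HasRankOne W
  | .o2, W => Module.finrank F W = 2 ∧ HasLeftKernel W
  | .o4T, W => Module.finrank F W = 2 ∧ ¬ HasLeftKernel W ∧ HasRankOne W ∧ AllRankLeOne W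
  | .o5, W => Module.finrank F W = 2 ∧ ¬ HasLeftKernel W ∧ HasRankOne W ∧ ¬ AllRankLeOne W ∧
      HasRankTwoSum W
  | .o6, W => Module.finrank F W = 2 ∧ ¬ HasLeftKernel W ∧ HasRankOne W ∧ ¬ AllRankLeOne W ∧
      ¬ HasRankTwoSum W ∧ HasRightKernel W
  | .o7, W => Module.finrank F W = 2 ∧ ¬ HasLeftKernel W ∧ HasRankOne W ∧ ¬ AllRankLeOne W ∧
      ¬ HasRankTwoSum W ∧ ¬ HasRightKernel W
  | .o10, W => Module.finrank F W = 2 ∧ ¬ HasLeftKernel W ∧ ¬ HasRankOne W ∧ HasRightKernel W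
  | .o11, W => Module.finrank F W = 2 ∧ ¬ HasLeftKernel W ∧ ¬ HasRankOne W ∧ ¬ HasRightKernel W

lemma trait_iff_of_matEquiv {W W' : Submodule F (Mat F)} (h : MatEquiv W W') (l : Label) :
    Trait l W ↔ Trait l W' := by
  have h0 := finrank_eq_of_matEquiv h
  have h1 : HasLeftKernel W ↔ HasLeftKernel W' := ⟨fun k => k.matEquiv h, fun k => k.matEquiv h.symm⟩
  have h2 : HasRightKernel W ↔ HasRightKernel W' :=
    ⟨fun k => k.matEquiv h, fun k => k.matEquiv h.symm⟩
  have h3 : HasRankOne W ↔ HasRankOne W' := ⟨fun k => k.matEquiv h, fun k => k.matEquiv h.symm⟩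
  have h4 : AllRankLeOne W ↔ AllRankLeOne W' := ⟨fun k => k.matEquiv h, fun k => k.matEquiv h.symm⟩
  have h5 : HasRankTwoSum W ↔ HasRankTwoSum W' :=
    ⟨fun k => k.matEquiv h, fun k => k.matEquiv h.symm⟩
  cases l <;> simp only [Trait, h0, h1, h2, h3, h4, h5]

/-- The traits are the leaves of a decision tree, so any two of them differ in the dimension or
contain a condition and its negation. -/
lemma eq_of_trait {W : Submodule F (Mat F)} {l l' : Label} (h : Trait l W) (h' : Trait l' W) :
    l = l' := by
  cases l <;> cases l' <;> simp only [Trait] at h h' <;> first | rfl | (exfalso; omega) | tauto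

lemma finrank_span_pair_eq_two {M N : Mat F} (h : ∀ x y : F, x • M + y • N = 0 → x = 0 ∧ y = 0) :
    Module.finrank F (Submodule.span F {M, N}) = 2 := by
  have := finrank_span_eq_card (R := F) (b := ![M, N]) (LinearIndependent.pair_iff.2 h)
  rwa [Matrix.range_cons_cons_empty, Fintype.card_fin] at this

lemma mem_span_pair_left {M N : Mat F} : M ∈ Submodule.span F {M, N} :=
  Submodule.subset_span (by simp)

lemma mem_span_pair_right {M N : Mat F} : N ∈ Submodule.span F {M, N} :=
  Submodule.subset_span (by simp)

lemma not_hasLeftKernel_span_pair {M N : Mat F}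
    (h : ∀ a : Fin 2 → F, Matrix.vecMul a M = 0 → Matrix.vecMul a N = 0 → a 0 = 0 ∧ a 1 = 0) :
    ¬ HasLeftKernel (Submodule.span F {M, N}) := by
  rintro ⟨a, ha, h'⟩
  obtain ⟨h0, h1⟩ := h a (h' _ mem_span_pair_left) (h' _ mem_span_pair_right)
  exact ha (funext fun i => by fin_cases i <;> simp [h0, h1])

lemma not_hasRightKernel_span_pair {M N : Mat F}
    (h : ∀ b : Fin 3 → F, Matrix.mulVec M b = 0 → Matrix.mulVec N b = 0 →
      b 0 = 0 ∧ b 1 = 0 ∧ b 2 = 0) :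
    ¬ HasRightKernel (Submodule.span F {M, N}) := by
  rintro ⟨b, hb, h'⟩
  obtain ⟨h0, h1, h2⟩ := h b (h' _ mem_span_pair_left) (h' _ mem_span_pair_right)
  exact hb (funext fun i => by fin_cases i <;> simp [h0, h1, h2])

lemma not_hasRankOne_span_pair {M N : Mat F}
    (h : ∀ x y : F, RankLeOne (x • M + y • N) → x = 0 ∧ y = 0) :
    ¬ HasRankOne (Submodule.span F {M, N}) := by
  rintro ⟨L, hL, h0, h1⟩
  obtain ⟨x, y, rfl⟩ := Submodule.mem_span_pair.1 hL
  obtain ⟨rfl, rfl⟩ := h x y h1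
  simp at h0

/-- If all members of rank at most one are multiples of N, they are closed under addition. This
separates o6 and o7, with one point of rank one, from o5, with two. -/
lemma not_hasRankTwoSum_span_pair {M N : Mat F} (hN : RankLeOne N)
    (h : ∀ x y : F, RankLeOne (x • M + y • N) → x = 0) :
    ¬ HasRankTwoSum (Submodule.span F {M, N}) := by
  rintro ⟨L, hL, L', hL', h1, h2, h3⟩
  obtain ⟨x, y, rfl⟩ := Submodule.mem_span_pair.1 hL
  obtain ⟨x', y', rfl⟩ := Submodule.mem_span_pair.1 hL'
  obtain rfl := h x y h1
  obtain rfl := h x' y' h2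
  obtain ⟨a, b, rfl⟩ := hN
  refine h3 ⟨(y + y') • a, b, ?_⟩
  rw [Matrix.smul_vecMulVec]
  module

lemma mat_ext_iff {R : Type*} {M N : Mat R} : M = N ↔ (M 0 0 = N 0 0 ∧ M 0 1 = N 0 1 ∧ M 0 2 = N 0 2) ∧
    M 1 0 = N 1 0 ∧ M 1 1 = N 1 1 ∧ M 1 2 = N 1 2 := by
  constructor
  · rintro rfl; simp
  · rintro ⟨⟨h1, h2, h3⟩, h4, h5, h6⟩
    ext i j
    fin_cases i <;> fin_cases j <;> assumption

lemma rankLeOne_of_eq {M : Mat F} (a₀ a₁ b₀ b₁ b₂ : F)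
    (h : M = !![a₀ * b₀, a₀ * b₁, a₀ * b₂; a₁ * b₀, a₁ * b₁, a₁ * b₂]) : RankLeOne M :=
  ⟨![a₀, a₁], ![b₀, b₁, b₂], by
    rw [h]; ext i j; fin_cases i <;> fin_cases j <;> simp [Matrix.vecMulVec_apply]⟩

/-- The equation `hm` says that the left 2 × 2 minor of x times the first plus y times the second
generator of the o10 pencil vanishes. For x ≠ 0 the quotient y / x would be a root of vλ² + uvλ − 1;
for x = 0 only vy² = 0 is left. -/
lemma eq_zero_of_minors {u v x y : F} (h : NoRoot u v) (hm : x * x = (x * u + y) * (y * v)) :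
    x = 0 ∧ y = 0 := by
  have hx : x = 0 := by
    by_contra hx
    refine h.2 (y / x) ?_
    field_simp
    linear_combination -hm
  subst hx
  refine ⟨rfl, ?_⟩
  have : y * y * v = 0 := by linear_combination -hm
  simpa [h.1] using this

/-- Common kernels are read off from the generators. Rank conditions come from minors of a general
member: for o6 and o7 a minor equals ±x², and for o11 two minors successively force x = 0 and y = 0.
-/
lemma trait_of_mem_pencil {l : Label} {C : Submodule F (Mat F)} (hC : C ∈ pencil F l) :
    Trait l C := by
  cases l
  case o1 =>
    obtain rfl := hC
    have hne : (!![1, 0, 0; 0, 0, 0] : Mat F) ≠ 0 := by simp [mat_ext_iff]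
    refine ⟨finrank_span_singleton hne, _, Submodule.mem_span_singleton_self _, hne,
      rankLeOne_of_eq 1 0 1 0 0 (by simp)⟩
  case o4 =>
    obtain rfl := hC
    refine ⟨finrank_span_singleton (by simp [mat_ext_iff]), ?_⟩
    rintro ⟨M, hM, h0, h1⟩
    obtain ⟨x, rfl⟩ := Submodule.mem_span_singleton.1 hM
    have := h1.minor 0 1
    simp at this
    simp [this] at h0
  case o2 =>
    obtain rfl := hC
    refine ⟨finrank_span_pair_eq_two (by simp [mat_ext_iff]), ![0, 1], by simp, ?_⟩
    intro M hM
    obtain ⟨x, y, rfl⟩ := Submodule.mem_span_pair.1 hM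
    ext j
    fin_cases j <;> simp [Matrix.vecMul, dotProduct, Fin.sum_univ_two]
  case o4T =>
    obtain rfl := hC
    refine ⟨finrank_span_pair_eq_two (by simp [mat_ext_iff]),
      not_hasLeftKernel_span_pair fun a h1 h2 => ?_, ⟨_, mem_span_pair_left, by simp [mat_ext_iff],
      rankLeOne_of_eq 1 0 1 0 0 (by simp)⟩, fun M hM => ?_⟩
    · have e1 := congrFun h1 0
      have e2 := congrFun h2 0
      simp [Matrix.vecMul, dotProduct, Fin.sum_univ_two] at e1 e2
      exact ⟨e1, e2⟩
    · obtain ⟨x, y, rfl⟩ := Submodule.mem_span_pair.1 hM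
      exact rankLeOne_of_eq x y 1 0 0 (by simp)
  case o5 =>
    obtain rfl := hC
    have hr : ¬ RankLeOne (!![1, 0, 0; 0, 0, 0] + !![0, 0, 0; 0, 1, 0] : Mat F) := fun h => by
      simpa using h.minor 0 1
    refine ⟨finrank_span_pair_eq_two (by simp [mat_ext_iff]),
      not_hasLeftKernel_span_pair fun a h1 h2 => ?_, ⟨_, mem_span_pair_left, by simp [mat_ext_iff],
      rankLeOne_of_eq 1 0 1 0 0 (by simp)⟩, fun h => hr (h _ (add_mem mem_span_pair_left
      mem_span_pair_right)), _, mem_span_pair_left, _, mem_span_pair_right,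
      rankLeOne_of_eq 1 0 1 0 0 (by simp), rankLeOne_of_eq 0 1 0 1 0 (by simp), hr⟩
    have e1 := congrFun h1 0
    have e2 := congrFun h2 1
    simp [Matrix.vecMul, dotProduct, Fin.sum_univ_two] at e1 e2
    exact ⟨e1, e2⟩
  case o6 =>
    obtain rfl := hC
    have hN : RankLeOne (!![0, 0, 0; 1, 0, 0] : Mat F) := rankLeOne_of_eq 0 1 1 0 0 (by simp)
    refine ⟨finrank_span_pair_eq_two (by simp +contextual [mat_ext_iff]),
      not_hasLeftKernel_span_pair fun a h1 h2 => ?_,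
      ⟨_, mem_span_pair_right, by simp [mat_ext_iff], hN⟩, fun h => ?_,
      not_hasRankTwoSum_span_pair hN fun x y h => ?_, ![0, 0, 1], by simp, ?_⟩
    · have e1 := congrFun h1 0
      have e2 := congrFun h1 1
      simp [Matrix.vecMul, dotProduct, Fin.sum_univ_two] at e1 e2
      exact ⟨e1, e2⟩
    · simpa using (h _ mem_span_pair_left).minor 0 1
    · simpa using h.minor 0 1
    · intro M hM
      obtain ⟨x, y, rfl⟩ := Submodule.mem_span_pair.1 hM
      ext j
      fin_cases j <;> simp [Matrix.mulVec, dotProduct, Fin.sum_univ_three]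
  case o7 =>
    obtain rfl := hC
    have hN : RankLeOne (!![0, 0, 0; 0, 1, 0] : Mat F) := rankLeOne_of_eq 0 1 0 1 0 (by simp)
    refine ⟨finrank_span_pair_eq_two (by simp +contextual [mat_ext_iff]),
      not_hasLeftKernel_span_pair fun a h1 h2 => ?_,
      ⟨_, mem_span_pair_right, by simp [mat_ext_iff], hN⟩, fun h => ?_,
      not_hasRankTwoSum_span_pair hN fun x y h => ?_,
      not_hasRightKernel_span_pair fun b h1 h2 => ?_⟩
    · have e1 := congrFun h1 2
      have e2 := congrFun h1 0
      simp [Matrix.vecMul, dotProduct, Fin.sum_univ_two] at e1 e2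
      exact ⟨e1, e2⟩
    · simpa using (h _ mem_span_pair_left).minor 0 2
    · simpa using (h.minor 0 2).symm
    · have e0 := congrFun h1 1
      have e1 := congrFun h2 1
      have e2 := congrFun h1 0
      simp [Matrix.mulVec, dotProduct, Fin.sum_univ_three] at e0 e1 e2
      exact ⟨e0, e1, e2⟩
  case o10 =>
    obtain ⟨u, v, h, rfl⟩ := hC
    refine ⟨finrank_span_pair_eq_two (by simp +contextual [mat_ext_iff]),
      not_hasLeftKernel_span_pair fun a h1 h2 => ?_,
      not_hasRankOne_span_pair fun x y hr => ?_, ![0, 0, 1], by simp, ?_⟩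
    · have e1 := congrFun h1 0
      have e2 := congrFun h1 1
      simp [Matrix.vecMul, dotProduct, Fin.sum_univ_two] at e1 e2
      rw [e1] at e2
      exact ⟨e1, by simpa using e2⟩
    · refine eq_zero_of_minors h ?_
      simpa using hr.minor 0 1
    · intro M hM
      obtain ⟨x, y, rfl⟩ := Submodule.mem_span_pair.1 hM
      ext j
      fin_cases j <;> simp [Matrix.mulVec, dotProduct, Fin.sum_univ_three]
  case o11 =>
    obtain rfl := hC
    refine ⟨finrank_span_pair_eq_two (by simp +contextual [mat_ext_iff]),
      not_hasLeftKernel_span_pair fun a h1 h2 => ?_,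
      not_hasRankOne_span_pair fun x y hr => ?_,
      not_hasRightKernel_span_pair fun b h1 h2 => ?_⟩
    · have e1 := congrFun h1 0
      have e2 := congrFun h1 1
      simp [Matrix.vecMul, dotProduct, Fin.sum_univ_two] at e1 e2
      exact ⟨e1, e2⟩
    · have e1 := hr.minor 0 1
      have e2 := hr.minor 1 2
      simp at e1
      subst e1
      simp at e2
      exact ⟨rfl, e2⟩
    · have e0 := congrFun h1 0
      have e1 := congrFun h1 1
      have e2 := congrFun h2 1
      simp [Matrix.mulVec, dotProduct, Fin.sum_univ_three] at e0 e1 e2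
      exact ⟨e0, e1, e2⟩

/-! ### Classification -/

lemma mat_eta {R : Type*} (M : Mat R) : M = !![M 0 0, M 0 1, M 0 2; M 1 0, M 1 1, M 1 2] := by
  simp [mat_ext_iff]

/-- Equivalence to a member of `pencil F l` for one of the labels of solids. -/
def Classified (W : Submodule F (Mat F)) : Prop :=
  ∃ l ∈ solidLabels, ∃ C ∈ pencil F l, MatEquiv C W

lemma Classified.of_matEquiv {W W' : Submodule F (Mat F)} (hW : Classified W')
    (h : MatEquiv W W') : Classified W := by
  obtain ⟨l, hl, C, hC, e⟩ := hW
  exact ⟨l, hl, C, hC, e.trans h.symm⟩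

lemma classified_of_mem {W : Submodule F (Mat F)} (l : Label) (hl : l ∈ solidLabels)
    (hW : W ∈ pencil F l) : Classified W :=
  ⟨l, hl, W, hW, .refl W⟩

lemma exists_eq_span_pair {W : Submodule F (Mat F)} (hW : Module.finrank F W = 2) {M : Mat F}
    (hM : M ∈ W) (h0 : M ≠ 0) : ∃ N, W = Submodule.span F {M, N} := by
  have hlt : Submodule.span F {M} < W := by
    refine lt_of_le_of_ne ((Submodule.span_singleton_le_iff_mem _ _).2 hM) fun h => ?_
    rw [← h, finrank_span_singleton h0] at hW
    omega
  obtain ⟨N, hN, hN'⟩ := SetLike.exists_of_lt hlt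
  refine ⟨N, (Submodule.eq_of_le_of_finrank_eq ?_ ?_).symm⟩
  · rw [Submodule.span_le, Set.insert_subset_iff, Set.singleton_subset_iff]
    exact ⟨hM, hN⟩
  · rw [hW]
    refine finrank_span_pair_eq_two fun x y h => ?_
    have hy : y = 0 := by
      by_contra hy
      refine hN' (Submodule.mem_span_singleton.2 ⟨-(y⁻¹ * x), ?_⟩)
      have : y⁻¹ • (x • M + y • N) = 0 := by rw [h, smul_zero]
      rw [smul_add, smul_smul, smul_smul, inv_mul_cancel₀ hy, one_smul] at this
      rw [neg_smul]
      exact neg_eq_of_add_eq_zero_right this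
    subst hy
    simpa [h0] using h

lemma ne_zero_of_finrank_span_pair {M N : Mat F}
    (h : Module.finrank F (Submodule.span F {M, N}) = 2) (x y : F)
    (hxy : x • M + y • N = 0) : x = 0 ∧ y = 0 := by
  have : LinearIndependent F ![M, N] := by
    rw [linearIndependent_iff_card_eq_finrank_span, Matrix.range_cons_cons_empty, Set.finrank, h]
    simp
  exact LinearIndependent.pair_iff.1 this x y hxy

/-- Column operations on the last two columns fix E₀₀, and multiples of E₀₀ can be added to N. If
the second row (d, e, f) has (e, f) ≠ 0, normalise that part to (1, 0) and clear a, b and d; the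
surviving entry c decides between o5 and o7. If (e, f) = 0 but (b, c) ≠ 0, the entry d decides
between o2 and o6. If both vanish, the pencil is o4T. -/
lemma classified_span_rank_one {N : Mat F}
    (h : Module.finrank F (Submodule.span F {!![1, 0, 0; 0, 0, 0], N}) = 2) :
    Classified (Submodule.span F {!![1, 0, 0; 0, 0, 0], N}) := by
  obtain ⟨a, b, c, d, e, f, rfl⟩ : ∃ a b c d e f, N = !![a, b, c; d, e, f] :=
    ⟨_, _, _, _, _, _, mat_eta N⟩
  by_cases hef : e ≠ 0 ∨ f ≠ 0
  · obtain ⟨p, q, r, s, hd, h1, h2⟩ := exists_pair_transform hef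
    refine Classified.of_matEquiv ?_ (matEquiv_span_pair 1 !![1, 0, 0; 0, p, q; 0, r, s] 1 0 0 1
      (N₁ := !![1, 0, 0; 0, 0, 0]) (N₂ := !![a, b * p + c * r, b * q + c * s; d, 1, 0])
      (by simp) (by simpa [Matrix.det_fin_three] using hd) (by simp)
      (by simp)
      (by simp [h1, h2]))
    generalize b * p + c * r = b'
    generalize b * q + c * s = c'
    -- The pivot 1 in the second row clears b' by a row operation and d by a column operation. This
    -- leaves a − b'd in the corner, which is cancelled by adding (b'd − a)E₀₀.
    refine Classified.of_matEquiv ?_ (matEquiv_span_pair !![1, -b'; 0, 1]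
      !![1, 0, 0; -d, 1, 0; 0, 0, 1] 1 0 (b' * d - a) 1
      (N₁ := !![1, 0, 0; 0, 0, 0]) (N₂ := !![0, 0, c'; 0, 1, 0])
      (by simp) (by simp [Matrix.det_fin_three]) (by simp)
      (by simp)
      (by simp; ring))
    by_cases hc : c' = 0
    · subst hc
      exact classified_of_mem .o5 (by simp [solidLabels]) rfl
    · refine Classified.of_matEquiv ?_ (matEquiv_span_pair !![0, 1; 1, 0]
        !![0, 1, 0; 0, 0, 1; c'⁻¹, 0, 0] 0 1 1 0
        (N₁ := !![0, 0, 1; 1, 0, 0]) (N₂ := !![0, 0, 0; 0, 1, 0])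
        (by simp) (by simp [Matrix.det_fin_three, hc]) (by simp)
        (by simp [hc])
        (by simp))
      exact classified_of_mem .o7 (by simp [solidLabels]) rfl
  push Not at hef
  obtain ⟨rfl, rfl⟩ := hef
  by_cases hbc : b ≠ 0 ∨ c ≠ 0
  · obtain ⟨p, q, r, s, hd, h1, h2⟩ := exists_pair_transform hbc
    refine Classified.of_matEquiv ?_ (matEquiv_span_pair 1 !![1, 0, 0; 0, p, q; 0, r, s]
      1 0 (-a) 1 (N₁ := !![1, 0, 0; 0, 0, 0]) (N₂ := !![0, 1, 0; d, 0, 0])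
      (by simp) (by simpa [Matrix.det_fin_three] using hd) (by simp)
      (by simp)
      (by simp [h1, h2]))
    by_cases hd0 : d = 0
    · subst hd0
      exact classified_of_mem .o2 (by simp [solidLabels]) rfl
    · refine Classified.of_matEquiv ?_ (matEquiv_span_pair !![0, d⁻¹; 1, 0] 1 0 1 1 0
        (N₁ := !![1, 0, 0; 0, 1, 0]) (N₂ := !![0, 0, 0; 1, 0, 0])
        (by simpa using hd0) (by simp) (by simp)
        (by simp [hd0, Matrix.mul_one])
        (by simp [Matrix.mul_one]))
      exact classified_of_mem .o6 (by simp [solidLabels]) rfl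
  · push Not at hbc
    obtain ⟨rfl, rfl⟩ := hbc
    have hd : d ≠ 0 := by
      rintro rfl
      have := ne_zero_of_finrank_span_pair h (-a) 1 (by simp [mat_ext_iff])
      simp at this
    refine Classified.of_matEquiv ?_ (matEquiv_span_pair 1 1 1 0 (-a * d⁻¹) d⁻¹
        (N₁ := !![1, 0, 0; 0, 0, 0]) (N₂ := !![0, 0, 0; 1, 0, 0])
        (by simp) (by simp) (by simpa using hd)
        (by simp)
        (by simp [hd, mul_comm]))
    exact classified_of_mem .o4T (by simp [solidLabels]) rfl

/-- The coefficient 1 of N keeps the member nonzero, because the generators are independent. -/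
lemma hasRankOne_span_pair {M N : Mat F}
    (h : Module.finrank F (Submodule.span F {M, N}) = 2) (x : F)
    (hr : RankLeOne (x • M + N)) : HasRankOne (Submodule.span F {M, N}) := by
  refine ⟨x • M + N, Submodule.mem_span_pair.2 ⟨x, 1, by simp⟩, fun h0 => ?_, hr⟩
  have := ne_zero_of_finrank_span_pair h x 1 (by simpa using h0)
  simp at this

/-- Write N = (A | w). Using P on rows and a multiple of P⁻¹ on the first two columns preserves the
line of (I | 0), conjugates A up to a scalar, and sends w to Pw. If w ≠ 0, it becomes (0, 1)ᵀ and
the pencil is o11; if w = 0, it is o10. The entries to be inverted are nonzero because otherwise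
subtracting a multiple of (I | 0) from N would leave a matrix of rank one. -/
lemma classified_span_rank_two {N : Mat F}
    (h : Module.finrank F (Submodule.span F {!![1, 0, 0; 0, 1, 0], N}) = 2)
    (hr : ¬ HasRankOne (Submodule.span F {!![1, 0, 0; 0, 1, 0], N})) :
    Classified (Submodule.span F {!![1, 0, 0; 0, 1, 0], N}) := by
  obtain ⟨a, b, c, d, e, f, rfl⟩ : ∃ a b c d e f, N = !![a, b, c; d, e, f] :=
    ⟨_, _, _, _, _, _, mat_eta N⟩
  by_cases hcf : f ≠ 0 ∨ c ≠ 0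
  · obtain ⟨s, q, r, p, hd, h1, h2⟩ := exists_pair_transform hcf
    have hd' : p * s - q * r ≠ 0 := by rwa [mul_comm p s]
    have step : ∃ a' b' d' e' : F, MatEquiv
        (Submodule.span F {!![1, 0, 0; 0, 1, 0], !![a, b, c; d, e, f]})
        (Submodule.span F {!![1, 0, 0; 0, 1, 0], !![a', b', 0; d', e', 1]}) := by
      -- The block of Q is the adjugate of P, so the first generator is multiplied by det P, and the
      -- coefficient (det P)⁻¹ restores it.
      refine ⟨_, _, _, _, matEquiv_span_pair !![p, q; r, s] !![s, -q, 0; -r, p, 0; 0, 0, 1]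
        (p * s - q * r)⁻¹ 0 0 1 (by simpa using hd')
        (by simpa [Matrix.det_fin_three, mul_comm] using hd) (by simpa using hd') ?_
        (by simp; exact ⟨⟨rfl, rfl, by linear_combination -h2⟩, rfl, rfl,
          by linear_combination -h1⟩)⟩
      have e : (p * s - q * r)⁻¹ * (p * s - q * r) = 1 := inv_mul_cancel₀ hd'
      simp
      refine ⟨⟨?_, ?_⟩, ?_, ?_⟩
      · linear_combination -e
      · right; ring
      · right; ring
      · linear_combination -e
    obtain ⟨a', b', d', e', step⟩ := step
    refine Classified.of_matEquiv ?_ step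
    have h' := (finrank_eq_of_matEquiv step).trans h
    have hr' := fun k : HasRankOne _ => hr (k.matEquiv step.symm)
    have hb : b' ≠ 0 := by
      rintro rfl
      exact hr' (hasRankOne_span_pair h' (-a')
        (rankLeOne_of_eq 0 1 d' (e' - a') 1 (by simp; ring)))
    refine Classified.of_matEquiv ?_ (matEquiv_span_pair 1
      !![1, 0, 0; 0, 1, 0; -d', a' - e', b'] 1 0 (-a' * b'⁻¹) b'⁻¹
      (N₁ := !![1, 0, 0; 0, 1, 0]) (N₂ := !![0, 1, 0; 0, 0, 1])
      (by simp) (by simpa [Matrix.det_fin_three] using hb) (by simpa using hb)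
      (by simp) (by simp [hb]; ring))
    exact classified_of_mem .o11 (by simp [solidLabels]) rfl
  · push Not at hcf
    obtain ⟨rfl, rfl⟩ := hcf
    have hb : b ≠ 0 := by
      rintro rfl
      exact hr (hasRankOne_span_pair h (-a) (rankLeOne_of_eq 0 1 d (e - a) 0 (by simp; ring)))
    have hd : d ≠ 0 := by
      rintro rfl
      exact hr (hasRankOne_span_pair h (-a) (rankLeOne_of_eq b (e - a) 0 1 0 (by simp; ring)))
    -- The shear makes the lower right entry of the second generator equal to a. Subtracting a times
    -- the first generator then clears both diagonal entries, and division by b leaves u = (a − e)/d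
    -- and v = d/b.
    have step := matEquiv_span_pair 1 !![1, (a - e) / d, 0; 0, 1, 0; 0, 0, 1] 1 0 (-a * b⁻¹) b⁻¹
      (M₁ := !![1, 0, 0; 0, 1, 0]) (M₂ := !![a, b, 0; d, e, 0])
      (N₁ := !![1, (a - e) / d, 0; 0, 1, 0]) (N₂ := !![0, 1, 0; d / b, 0, 0])
      (by simp) (by simp [Matrix.det_fin_three]) (by simpa using hb)
      (by simp)
      (by simp; refine ⟨⟨?_, ?_⟩, ?_, ?_⟩ <;> field_simp <;> ring)
    refine Classified.of_matEquiv ?_ step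
    refine classified_of_mem .o10 (by simp [solidLabels]) ⟨_, _, ⟨by simp [hb, hd], ?_⟩, rfl⟩
    intro x hx
    -- A root x makes the first generator plus x times the second one a matrix of rank one.
    refine hr (HasRankOne.matEquiv ⟨_, Submodule.mem_span_pair.2 ⟨1, x, rfl⟩, ?_, ?_⟩ step.symm)
    · simp [mat_ext_iff]
    · refine rankLeOne_of_eq 1 (x * (d / b)) 1 ((a - e) / d + x) 0 ?_
      simp
      linear_combination -hx

/-- Every space of `2 × 3` matrices of dimension two is equivalent to a contraction space of a
canonical form. -/
theorem classified_of_finrank_eq_two {W : Submodule F (Mat F)} (hW : Module.finrank F W = 2) :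
    Classified W := by
  by_cases hr : HasRankOne W
  · obtain ⟨M, hM, h0, a, b, rfl⟩ := hr
    obtain ⟨N, rfl⟩ := exists_eq_span_pair hW hM h0
    have ha : a ≠ 0 := by rintro rfl; exact h0 (by ext; simp [Matrix.vecMulVec_apply])
    have hb : b ≠ 0 := by rintro rfl; exact h0 (by ext; simp [Matrix.vecMulVec_apply])
    obtain ⟨N', e⟩ := (matRel_vecMulVec ha hb).span_pair N
    exact (classified_span_rank_one ((finrank_eq_of_matEquiv e).trans hW)).of_matEquiv e
  · have hne : W ≠ ⊥ := by rintro rfl; simp at hW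
    obtain ⟨M, hM, h0⟩ := Submodule.exists_mem_ne_zero_of_ne_bot hne
    obtain ⟨N, rfl⟩ := exists_eq_span_pair hW hM h0
    rcases matRel_canonical h0 with h | h
    -- This case cannot occur, but the classification with a rank-one generator disposes of it
    -- without a contradiction.
    · obtain ⟨N', e⟩ := h.span_pair N
      exact (classified_span_rank_one ((finrank_eq_of_matEquiv e).trans hW)).of_matEquiv e
    · obtain ⟨N', e⟩ := h.span_pair N
      exact (classified_span_rank_two ((finrank_eq_of_matEquiv e).trans hW)
        fun k => hr (k.matEquiv e.symm)).of_matEquiv e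

theorem exists_matEquiv_of_finrank_eq_one {W : Submodule F (Mat F)}
    (hW : Module.finrank F W = 1) :
    ∃ l ∈ hyperplaneLabels, ∃ C ∈ pencil F l, MatEquiv C W := by
  have hne : W ≠ ⊥ := by rintro rfl; simp at hW
  obtain ⟨M, hM, h0⟩ := Submodule.exists_mem_ne_zero_of_ne_bot hne
  obtain rfl : Submodule.span F {M} = W := Submodule.eq_of_le_of_finrank_eq
    ((Submodule.span_singleton_le_iff_mem _ _).2 hM) (by rw [hW, finrank_span_singleton h0])
  rcases matRel_canonical h0 with h | h
  · exact ⟨.o1, by simp [hyperplaneLabels], _, rfl, h.span_singleton.symm⟩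
  · exact ⟨.o4, by simp [hyperplaneLabels], _, rfl, h.span_singleton.symm⟩

/-! ### The parametrised family o10 over algebraically closed fields and over ℝ. -/

lemma pencil_o10_of_isAlgClosed [IsAlgClosed F] : pencil F .o10 = ∅ := by
  rw [Set.eq_empty_iff_forall_notMem]
  rintro _ ⟨u, v, ⟨hv, h⟩, rfl⟩
  obtain ⟨x, hx⟩ := IsAlgClosed.exists_root
    (Polynomial.C v * Polynomial.X ^ 2 + Polynomial.C (u * v) * Polynomial.X + Polynomial.C (-1))
    (by rw [Polynomial.degree_quadratic hv]; decide)
  refine h x ?_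
  simpa [sub_eq_add_neg] using hx

/-- The left minor of xM₁ + yM₂ is x² − uvxy − vy² = (x − uvy/2)² + s²y² with s² = −((uv)² + 4v)/4.
This is positive, since otherwise the quadratic formula would give a root. A pencil whose minor is a
sum of two squares can be brought to the form spanned by the identity and a rotation. -/
lemma matEquiv_real_o10 {u v : ℝ} (h : NoRoot u v) :
    MatEquiv (Submodule.span ℝ {!![1, u, 0; 0, 1, 0], !![0, 1, 0; v, 0, 0]})
      (Submodule.span ℝ {!![1, 0, 0; 0, 1, 0], !![0, 1, 0; -1, 0, 0]}) := by
  have hD : (u * v) ^ 2 + 4 * v < 0 := by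
    by_contra! hD
    refine h.2 ((-(u * v) + √((u * v) ^ 2 + 4 * v)) / (2 * v)) ?_
    have hs := Real.sq_sqrt hD
    have hv := h.1
    generalize √((u * v) ^ 2 + 4 * v) = r at hs
    field_simp
    linear_combination hs
  set s := √(-((u * v) ^ 2 + 4 * v) / 4) with hs'
  have hs : s ^ 2 = -((u * v) ^ 2 + 4 * v) / 4 := Real.sq_sqrt (by linarith)
  have hs0 : s ≠ 0 := by rintro h0; rw [h0] at hs; linarith
  clear_value s
  -- The new basis M₁, (uv/(2s))M₁ + s⁻¹M₂ turns the minor form into x² + y². P and Q are chosen to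
  -- bring these two members to their normal forms at once; their determinants are s⁻¹ and s.
  refine matEquiv_span_pair !![1, 0; u * v / (2 * s), s⁻¹]
    !![1 + u * (u * v) / 2, -(u * s), 0; -(u * v) / 2, s, 0; 0, 0, 1] 1 0 (u * v / (2 * s)) s⁻¹
    (by simpa using hs0) ?_ (by simpa using hs0) ?_ ?_
  · simp [Matrix.det_fin_three]
    convert hs0 using 2
    ring
  · simp
    refine ⟨?_, ?_, ?_⟩ <;> field_simp <;> ring
  · simp
    refine ⟨⟨?_, ?_⟩, ?_, ?_⟩ <;> field_simp
    · ring
    · linear_combination -8 * hs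
    · ring

/-! ### Orbits -/

/-- The subspaces whose space of equations is equivalent to a member of `pencil F l`. -/
def dualOrbit (F : Type u) [Field F] (l : Label) : Set (Submodule F (V F)) :=
  {U | ∃ C ∈ pencil F l, MatEquiv C (dualOf U)}

lemma perpOrbit_eq_dualOrbit {β₁ : LinearMap.BilinForm F (Fin 2 → F)}
    {β₂ : LinearMap.BilinForm F (Fin 3 → F)} (h₁ : β₁.Nondegenerate) (h₂ : β₂.Nondegenerate) :
    perpOrbit β₁ β₂ = dualOrbit F :=
  funext fun l => Set.ext fun U => mem_perpOrbit_iff h₁ h₂ l U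

/-- A label yields a single K-orbit once its canonical pencils are pairwise equivalent. Only for o10
is this more than reflexivity. -/
lemma dualOrbit_eq_subspaceOrbit {l : Label}
    (hl : ∀ C ∈ pencil F l, ∀ C' ∈ pencil F l, MatEquiv C C') {C : Submodule F (Mat F)}
    (hC : C ∈ pencil F l) {U : Submodule F (V F)} (hU : MatEquiv C (dualOf U)) :
    dualOrbit F l = subspaceOrbit U := by
  ext W
  rw [mem_subspaceOrbit_iff_dualOf]
  constructor
  · rintro ⟨C', hC', h⟩
    exact hU.symm.trans ((hl _ hC _ hC').trans h)
  · intro h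
    exact ⟨C, hC, hU.trans h⟩

/-- The orbits of subspaces of vector dimension `n`. -/
def orbitsOfFinrank (F : Type u) [Field F] (n : ℕ) : Set (Set (Submodule F (V F))) :=
  {O | ∃ U : Submodule F (V F), Module.finrank F U = n ∧ O = subspaceOrbit U}

/-- Labels map to orbits by nonemptiness and mutual equivalence of their pencils, injectively by the
traits, and onto by the classification `hcl`. The bound n ≤ 6 makes 6 − n a genuine codimension. -/
lemma bijOn_dualOrbit {L : Set Label} {n : ℕ} (hn : n ≤ 6)
    (hne : ∀ l ∈ L, (pencil F l).Nonempty)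
    (hdim : ∀ l ∈ L, ∀ C ∈ pencil F l, Module.finrank F C = n)
    (hl : ∀ l ∈ L, ∀ C ∈ pencil F l, ∀ C' ∈ pencil F l, MatEquiv C C')
    (hcl : ∀ W : Submodule F (Mat F), Module.finrank F W = n →
      ∃ l ∈ L, ∃ C ∈ pencil F l, MatEquiv C W) :
    Set.BijOn (dualOrbit F) L (orbitsOfFinrank F (6 - n)) := by
  refine ⟨fun l h => ?_, fun l h l' h' e => ?_, ?_⟩
  · obtain ⟨C, hC⟩ := hne l h
    refine ⟨solutions C, by rw [finrank_solutions, hdim l h C hC], ?_⟩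
    exact dualOrbit_eq_subspaceOrbit (hl l h) hC (by rw [dualOf_solutions]; exact .refl C)
  · obtain ⟨C, hC⟩ := hne l h
    have hU : solutions C ∈ dualOrbit F l := ⟨C, hC, by rw [dualOf_solutions]; exact .refl C⟩
    rw [e] at hU
    obtain ⟨C', hC', hCC'⟩ := hU
    rw [dualOf_solutions] at hCC'
    exact eq_of_trait (trait_of_mem_pencil hC)
      ((trait_iff_of_matEquiv hCC' l').1 (trait_of_mem_pencil hC'))
  · rintro _ ⟨U, hU, rfl⟩
    obtain ⟨l, h, C, hC, e⟩ := hcl (dualOf U) (by rw [finrank_dualOf]; omega)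
    exact ⟨l, h, dualOrbit_eq_subspaceOrbit (hl l h) hC e⟩

lemma pencil_nonempty_of_ne {l : Label} (hl : l ≠ .o10) : (pencil F l).Nonempty := by
  cases l <;> first | exact Set.singleton_nonempty _ | exact absurd rfl hl

lemma matEquiv_of_mem_pencil_of_ne {l : Label} (hl : l ≠ .o10) :
    ∀ C ∈ pencil F l, ∀ C' ∈ pencil F l, MatEquiv C C' := by
  intro C hC C' hC'
  cases l <;> first | exact absurd rfl hl | (obtain rfl := hC; obtain rfl := hC'; exact .refl _)

lemma finrank_of_mem_pencil_solid {l : Label} (hl : l ∈ solidLabels) (C : Submodule F (Mat F))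
    (hC : C ∈ pencil F l) : Module.finrank F C = 2 := by
  have h := trait_of_mem_pencil hC
  cases l <;> simp [solidLabels] at hl <;> exact h.1

lemma finrank_of_mem_pencil_hyperplane {l : Label} (hl : l ∈ hyperplaneLabels)
    (C : Submodule F (Mat F)) (hC : C ∈ pencil F l) : Module.finrank F C = 1 := by
  have h := trait_of_mem_pencil hC
  cases l <;> simp [hyperplaneLabels] at hl <;> exact h.1

lemma ne_o10_of_mem_hyperplaneLabels {l : Label} (hl : l ∈ hyperplaneLabels) : l ≠ .o10 := by
  rintro rfl
  simp [hyperplaneLabels] at hl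

theorem bijOn_hyperplaneOrbits :
    Set.BijOn (dualOrbit F) hyperplaneLabels (hyperplaneOrbits F) :=
  bijOn_dualOrbit (n := 1) (by norm_num)
    (fun _ hl => pencil_nonempty_of_ne (ne_o10_of_mem_hyperplaneLabels hl))
    (fun _ hl => finrank_of_mem_pencil_hyperplane hl)
    (fun _ hl => matEquiv_of_mem_pencil_of_ne (ne_o10_of_mem_hyperplaneLabels hl))
    (fun _ hW => exists_matEquiv_of_finrank_eq_one hW)

theorem bijOn_solidOrbits_of_isAlgClosed [IsAlgClosed F] :
    Set.BijOn (dualOrbit F) (solidLabels \ {.o10}) (solidOrbits F) :=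
  bijOn_dualOrbit (n := 2) (by norm_num)
    (fun _ hl => pencil_nonempty_of_ne hl.2)
    (fun _ hl => finrank_of_mem_pencil_solid hl.1)
    (fun _ hl => matEquiv_of_mem_pencil_of_ne hl.2)
    (fun W hW => by
      obtain ⟨l, hl, C, hC, h⟩ := classified_of_finrank_eq_two hW
      refine ⟨l, ⟨hl, ?_⟩, C, hC, h⟩
      rintro rfl
      simp [pencil_o10_of_isAlgClosed] at hC)

theorem bijOn_solidOrbits_real :
    Set.BijOn (dualOrbit ℝ) solidLabels (solidOrbits ℝ) := by
  refine bijOn_dualOrbit (n := 2) (by norm_num) (fun l _ => ?_)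
    (fun _ hl => finrank_of_mem_pencil_solid hl) (fun l _ => ?_)
    (fun _ hW => classified_of_finrank_eq_two hW)
  · by_cases h : l = .o10
    · subst h
      -- For u = 0 and v = −1 the polynomial is −λ² − 1, which has no real root.
      exact ⟨_, 0, -1, ⟨by norm_num, fun x => by nlinarith [sq_nonneg x]⟩, rfl⟩
    · exact pencil_nonempty_of_ne h
  · by_cases h : l = .o10
    · subst h
      rintro _ ⟨u, v, h, rfl⟩ _ ⟨u', v', h', rfl⟩
      exact (matEquiv_real_o10 h).trans (matEquiv_real_o10 h').symm
    · exact matEquiv_of_mem_pencil_of_ne h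

lemma ncard_hyperplaneLabels : hyperplaneLabels.ncard = 2 :=
  Set.ncard_pair (by simp)

lemma solidLabels_diff_o10 :
    solidLabels \ {.o10} = {.o2, .o4T, .o5, .o6, .o7, .o11} := by
  ext l
  cases l <;> simp [solidLabels]

lemma ncard_solidLabels_diff_o10 : (solidLabels \ {.o10}).ncard = 6 := by
  rw [solidLabels_diff_o10]
  repeat rw [Set.ncard_insert_of_notMem (by simp)]
  rw [Set.ncard_singleton]

lemma ncard_solidLabels : solidLabels.ncard = 7 := by
  have h : (Label.o10) ∈ solidLabels := by simp [solidLabels]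
  have hf : solidLabels.Finite := by simp [solidLabels]
  rw [← Set.ncard_sdiff_singleton_add_one h hf, ncard_solidLabels_diff_o10]

/-! ### The column of representatives -/

lemma toTensor_toMat (t : V F) : toTensor (toMat t) = t :=
  toMat.injective (toMat_toTensor _)

lemma toTensor_inj {M N : Mat F} : toTensor M = toTensor N ↔ M = N :=
  ⟨fun h => by simpa using congrArg toMat h, fun h => h ▸ rfl⟩

lemma toTensor_mem_solutions {W : Submodule F (Mat F)} {M : Mat F} :
    toTensor M ∈ solutions W ↔ M ∈ mperp W := by
  rw [mem_solutions, toMat_toTensor]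

lemma mem_mperp_singleton {M N : Mat F} :
    M ∈ mperp (Submodule.span F {N}) ↔ matForm N M = 0 := by
  simp [mem_mperp_span]

lemma mem_mperp_pair {M N₁ N₂ : Mat F} :
    M ∈ mperp (Submodule.span F {N₁, N₂}) ↔ matForm N₁ M = 0 ∧ matForm N₂ M = 0 := by
  simp [mem_mperp_span]

/-- The matrices listed in a table row already form a subspace, so the span adds nothing and it
suffices to compare linear equations. -/
lemma span_eq_solutions {S : Set (V F)} {W : Submodule F (Mat F)}
    (h : ∀ M, toTensor M ∈ S ↔ M ∈ mperp W) : Submodule.span F S = solutions W := by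
  have : S = solutions W := by
    ext t
    rw [← toTensor_toMat t, h]
    exact toTensor_mem_solutions.symm
  rw [this, Submodule.span_eq]

lemma solutions_mem_dualOrbit {l : Label} {C : Submodule F (Mat F)} (hC : C ∈ pencil F l) :
    solutions C ∈ dualOrbit F l :=
  ⟨C, hC, by rw [dualOf_solutions]; exact .refl C⟩

lemma span_mem_dualOrbit {l : Label} {C : Submodule F (Mat F)} (hC : C ∈ pencil F l)
    {S : Set (V F)} (h : ∀ M, toTensor M ∈ S ↔ M ∈ mperp C) :
    Submodule.span F S ∈ dualOrbit F l := by
  rw [span_eq_solutions h]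
  exact solutions_mem_dualOrbit hC

lemma tableRep_subset_dualOrbit (l : Label) : tableRep F l ⊆ dualOrbit F l := by
  intro R hR
  cases l
  case o7 =>
    obtain rfl := hR
    -- The listed representative of o7 satisfies the equations of the canonical pencil with its two
    -- rows exchanged.
    rw [span_eq_solutions (W := Submodule.span F {!![1, 0, 0; 0, 0, 1], !![0, 1, 0; 0, 0, 0]})]
    · refine ⟨_, rfl, ?_⟩
      rw [dualOf_solutions]
      exact matEquiv_span_pair !![0, 1; 1, 0] 1 1 0 0 1 (by simp) (by simp) (by simp)
        (by simp [Matrix.mul_one]) (by simp [Matrix.mul_one])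
    · intro M
      rw [mem_mperp_pair, matForm_eq, matForm_eq]
      simp only [Set.mem_ofPred_eq, toTensor_inj]
      constructor
      · rintro ⟨x, y, z, w, rfl⟩; simp
      · rintro ⟨h1, h2⟩
        refine ⟨M 0 0, M 0 2, M 1 0, M 1 1, ?_⟩
        simp at h1 h2
        simp [mat_ext_iff, h2]
        linear_combination h1
  case o10 =>
    obtain ⟨u, v, h, rfl⟩ := hR
    refine span_mem_dualOrbit (F := F) (l := .o10) ⟨u, v, h, rfl⟩ fun M => ?_
    rw [mem_mperp_pair, matForm_eq, matForm_eq]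
    simp only [Set.mem_ofPred_eq, toTensor_inj]
    constructor
    · rintro ⟨x, y, z, w, rfl⟩; simp; ring
    · rintro ⟨h1, h2⟩
      refine ⟨M 0 0, M 1 0, M 0 2, M 1 2, ?_⟩
      simp at h1 h2
      simp [mat_ext_iff]
      exact ⟨by linear_combination h2, by linear_combination h1 - u * h2⟩
  case o1 =>
    obtain rfl := hR
    refine span_mem_dualOrbit rfl fun M => ?_
    rw [mem_mperp_singleton, matForm_eq]
    simp only [Set.mem_ofPred_eq, toTensor_inj]
    constructor
    · rintro ⟨x, y, z, w, r, rfl⟩; simp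
    · intro h1
      refine ⟨M 0 1, M 0 2, M 1 0, M 1 1, M 1 2, ?_⟩
      simp at h1
      simp [mat_ext_iff, h1]
  case o4 =>
    obtain rfl := hR
    refine span_mem_dualOrbit rfl fun M => ?_
    rw [mem_mperp_singleton, matForm_eq]
    simp only [Set.mem_ofPred_eq, toTensor_inj]
    constructor
    · rintro ⟨x, y, z, w, r, rfl⟩; simp
    · intro h1
      refine ⟨M 0 0, M 0 1, M 0 2, M 1 0, M 1 2, ?_⟩
      simp at h1
      simp [mat_ext_iff]
      linear_combination h1
  case o2 =>
    obtain rfl := hR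
    refine span_mem_dualOrbit rfl fun M => ?_
    rw [mem_mperp_pair, matForm_eq, matForm_eq]
    simp only [Set.mem_ofPred_eq, toTensor_inj]
    constructor
    · rintro ⟨x, y, z, w, rfl⟩; simp
    · rintro ⟨h1, h2⟩
      refine ⟨M 0 2, M 1 0, M 1 1, M 1 2, ?_⟩
      simp at h1 h2
      simp [mat_ext_iff, h1, h2]
  case o4T =>
    obtain rfl := hR
    refine span_mem_dualOrbit rfl fun M => ?_
    rw [mem_mperp_pair, matForm_eq, matForm_eq]
    simp only [Set.mem_ofPred_eq, toTensor_inj]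
    constructor
    · rintro ⟨x, y, z, w, rfl⟩; simp
    · rintro ⟨h1, h2⟩
      refine ⟨M 0 1, M 0 2, M 1 1, M 1 2, ?_⟩
      simp at h1 h2
      simp [mat_ext_iff, h1, h2]
  case o5 =>
    obtain rfl := hR
    refine span_mem_dualOrbit rfl fun M => ?_
    rw [mem_mperp_pair, matForm_eq, matForm_eq]
    simp only [Set.mem_ofPred_eq, toTensor_inj]
    constructor
    · rintro ⟨x, y, z, w, rfl⟩; simp
    · rintro ⟨h1, h2⟩
      refine ⟨M 0 1, M 0 2, M 1 0, M 1 2, ?_⟩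
      simp at h1 h2
      simp [mat_ext_iff, h1, h2]
  case o6 =>
    obtain rfl := hR
    refine span_mem_dualOrbit rfl fun M => ?_
    rw [mem_mperp_pair, matForm_eq, matForm_eq]
    simp only [Set.mem_ofPred_eq, toTensor_inj]
    constructor
    · rintro ⟨x, y, z, w, rfl⟩; simp
    · rintro ⟨h1, h2⟩
      refine ⟨M 0 0, M 0 1, M 0 2, M 1 2, ?_⟩
      simp at h1 h2
      simp [mat_ext_iff, h2]
      linear_combination h1
  case o11 =>
    obtain rfl := hR
    refine span_mem_dualOrbit rfl fun M => ?_
    rw [mem_mperp_pair, matForm_eq, matForm_eq]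
    simp only [Set.mem_ofPred_eq, toTensor_inj]
    constructor
    · rintro ⟨x, y, z, w, rfl⟩; simp
    · rintro ⟨h1, h2⟩
      refine ⟨M 0 0, M 0 1, M 0 2, M 1 0, ?_⟩
      simp at h1 h2
      simp [mat_ext_iff]
      exact ⟨by linear_combination h1, by linear_combination h2⟩

/-! ### Invariance of the columns of the tables -/

/-- The collineation of `PG(F² ⊗ F³)` induced by a linear automorphism. -/
def collineation (T : V F ≃ₗ[F] V F) : ℙ F (V F) → ℙ F (V F) :=
  Projectivization.map T.toLinearMap T.injective

lemma submodule_collineation (T : V F ≃ₗ[F] V F) (p : ℙ F (V F)) :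
    (collineation T p).submodule = p.submodule.map T.toLinearMap := by
  induction p using Projectivization.ind with
  | h v hv =>
    rw [collineation, Projectivization.map_mk, Projectivization.submodule_mk,
      Projectivization.submodule_mk, Submodule.map_span, Set.image_singleton]

lemma collineation_surjective (T : V F ≃ₗ[F] V F) : Function.Surjective (collineation T) := by
  intro p
  refine ⟨collineation T.symm p, Projectivization.submodule_injective ?_⟩
  rw [submodule_collineation, submodule_collineation, ← Submodule.map_comp]
  simp

lemma map_eq_span_singleton_iff (T : V F ≃ₗ[F] V F) (L : Submodule F (V F)) (v : V F) :
    L.map T.toLinearMap = Submodule.span F {v} ↔ L = Submodule.span F {T.symm v} := by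
  have : Submodule.span F {v} = (Submodule.span F {T.symm v}).map T.toLinearMap := by
    simp [Submodule.map_span]
  rw [this]
  exact (Submodule.map_injective_of_injective T.injective).eq_iff

lemma preimage_pg (T : V F ≃ₗ[F] V F) (U : Submodule F (V F)) :
    collineation T ⁻¹' pg U = pg (U.map T.symm.toLinearMap) := by
  ext p
  change (collineation T p).submodule ≤ U ↔ p.submodule ≤ _
  rw [submodule_collineation, Submodule.map_le_iff_le_comap, Submodule.map_equiv_eq_comap_symm]
  rfl

lemma preimage_segreOver (g : (Fin 2 → F) ≃ₗ[F] (Fin 2 → F)) (h : (Fin 3 → F) ≃ₗ[F] (Fin 3 → F))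
    (B : Submodule F (Fin 3 → F)) :
    collineation (TensorProduct.congr g h) ⁻¹' segreOver B =
      segreOver (B.map h.symm.toLinearMap) := by
  ext p
  simp only [segreOver, Set.mem_preimage, Set.mem_ofPred_eq, submodule_collineation,
    map_eq_span_singleton_iff, TensorProduct.congr_symm_tmul]
  constructor
  · rintro ⟨a, b, ha, hb, hB, e⟩
    exact ⟨g.symm a, h.symm b, by simpa using ha, by simpa using hb,
      Submodule.mem_map_of_mem hB, e⟩
  · rintro ⟨a, b, ha, hb, ⟨b', hB, rfl⟩, e⟩
    exact ⟨g a, b', by simpa using ha, by rintro rfl; simp at hb, hB, by simpa using e⟩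

lemma preimage_segre (g : (Fin 2 → F) ≃ₗ[F] (Fin 2 → F)) (h : (Fin 3 → F) ≃ₗ[F] (Fin 3 → F)) :
    collineation (TensorProduct.congr g h) ⁻¹' segre F = segre F := by
  rw [segre, preimage_segreOver, Submodule.map_top, LinearEquiv.range]

lemma IsPlane.preimage {S : Set (ℙ F (V F))} (hS : IsPlane S) (T : V F ≃ₗ[F] V F) :
    IsPlane (collineation T ⁻¹' S) := by
  obtain ⟨P, hP, rfl⟩ := hS
  exact ⟨_, (LinearEquiv.finrank_map_eq T.symm P).trans hP, preimage_pg T P⟩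

lemma IsLine.preimage {S : Set (ℙ F (V F))} (hS : IsLine S) (T : V F ≃ₗ[F] V F) :
    IsLine (collineation T ⁻¹' S) := by
  obtain ⟨P, hP, rfl⟩ := hS
  exact ⟨_, (LinearEquiv.finrank_map_eq T.symm P).trans hP, preimage_pg T P⟩

lemma IsSegre22.preimage {S : Set (ℙ F (V F))} (hS : IsSegre22 S)
    (g : (Fin 2 → F) ≃ₗ[F] (Fin 2 → F)) (h : (Fin 3 → F) ≃ₗ[F] (Fin 3 → F)) :
    IsSegre22 (collineation (TensorProduct.congr g h) ⁻¹' S) := by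
  obtain ⟨B, hB, rfl⟩ := hS
  exact ⟨_, (LinearEquiv.finrank_map_eq h.symm B).trans hB, preimage_segreOver g h B⟩

lemma IsNormalRationalCurve.preimage {n : ℕ} {S : Set (ℙ F (V F))}
    (hS : IsNormalRationalCurve n S) (T : V F ≃ₗ[F] V F) :
    IsNormalRationalCurve n (collineation T ⁻¹' S) := by
  obtain ⟨f, hf, rfl⟩ := hS
  refine ⟨fun i => T.symm (f i), hf.map' T.symm.toLinearMap T.symm.ker, ?_⟩
  ext p
  simp only [Set.mem_preimage, Set.mem_ofPred_eq, submodule_collineation,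
    map_eq_span_singleton_iff, map_sum, map_smul]

lemma IsCubicScroll.preimage {S : Set (ℙ F (V F))} (hS : IsCubicScroll S) (T : V F ≃ₗ[F] V F) :
    IsCubicScroll (collineation T ⁻¹' S) := by
  obtain ⟨e, f, hf, rfl⟩ := hS
  refine ⟨fun i => T.symm (e i), fun i => T.symm (f i), ?_, ?_⟩
  · have := hf.map' T.symm.toLinearMap T.symm.ker
    have e' : T.symm.toLinearMap ∘ Sum.elim e f =
        Sum.elim (fun i => T.symm (e i)) (fun i => T.symm (f i)) := by
      ext i
      cases i <;> rfl
    rwa [e'] at this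
  · ext p
    simp only [Set.mem_preimage, Set.mem_ofPred_eq, submodule_collineation,
      map_eq_span_singleton_iff, map_add, map_smul]

/-- Preimages commute with unions definitionally. Along a surjection they also preserve
distinctness, non-inclusion and nonempty intersection, so each clause transfers separately. -/
lemma TableIntersection.preimage {l : Label} {S : Set (ℙ F (V F))} (hS : TableIntersection S l)
    (g : (Fin 2 → F) ≃ₗ[F] (Fin 2 → F)) (h : (Fin 3 → F) ≃ₗ[F] (Fin 3 → F)) :
    TableIntersection (collineation (TensorProduct.congr g h) ⁻¹' S) l := by
  have hs := collineation_surjective (TensorProduct.congr g h)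
  have hinj := hs.preimage_injective
  cases l
  case o1 =>
    obtain ⟨P, Q, hP, hQ, rfl⟩ := hS
    exact ⟨_, _, hP.preimage _, hQ.preimage g h, rfl⟩
  case o2 =>
    obtain ⟨P, L, hP, hL, hn, rfl⟩ := hS
    exact ⟨_, _, hP.preimage _, hL.preimage _,
      fun hsub => hn (hs.preimage_subset_preimage_iff.1 hsub), rfl⟩
  case o4 => exact IsCubicScroll.preimage hS _
  case o4T => exact IsSegre22.preimage hS g h
  case o5 =>
    obtain ⟨L₁, L₂, L₃, h1, h2, h3, h12, h13, h23, rfl⟩ := hS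
    exact ⟨_, _, _, h1.preimage _, h2.preimage _, h3.preimage _, hinj.ne h12, hinj.ne h13,
      hinj.ne h23, rfl⟩
  case o6 =>
    obtain ⟨L₁, L₂, h1, h2, h12, hne, rfl⟩ := hS
    exact ⟨_, _, h1.preimage _, h2.preimage _, hinj.ne h12, hne.preimage hs, rfl⟩
  case o7 =>
    obtain ⟨C, L, hC, hL, rfl⟩ := hS
    exact ⟨_, _, IsNormalRationalCurve.preimage hC _, hL.preimage _, rfl⟩
  case o10 => exact IsLine.preimage hS _
  case o11 => exact IsNormalRationalCurve.preimage hS _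

lemma tensorSubspace_map (g : (Fin 2 → F) ≃ₗ[F] (Fin 2 → F))
    (h : (Fin 3 → F) ≃ₗ[F] (Fin 3 → F)) (A : Submodule F (Fin 2 → F))
    (B : Submodule F (Fin 3 → F)) :
    tensorSubspace (A.map g.toLinearMap) (B.map h.toLinearMap) =
      (tensorSubspace A B).map (TensorProduct.congr g h).toLinearMap := by
  rw [tensorSubspace, tensorSubspace, Submodule.map₂_map_map, Submodule.map_map₂]
  rfl

lemma MinSegre.map {U : Submodule F (V F)} {m n : ℕ} (hU : MinSegre U m n)
    (g : (Fin 2 → F) ≃ₗ[F] (Fin 2 → F)) (h : (Fin 3 → F) ≃ₗ[F] (Fin 3 → F)) :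
    MinSegre (U.map (TensorProduct.congr g h).toLinearMap) m n := by
  obtain ⟨A, B, hA, hB, hle, hmin⟩ := hU
  refine ⟨A.map g.toLinearMap, B.map h.toLinearMap,
    (LinearEquiv.finrank_map_eq g A).trans hA,
    (LinearEquiv.finrank_map_eq h B).trans hB,
    by rw [tensorSubspace_map]; exact Submodule.map_mono hle, fun A' B' h' => ?_⟩
  have hA' : (A'.map g.symm.toLinearMap).map g.toLinearMap = A' := by
    rw [← Submodule.map_comp]; simp
  have hB' : (B'.map h.symm.toLinearMap).map h.toLinearMap = B' := by
    rw [← Submodule.map_comp]; simp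
  rw [← hA', ← hB', tensorSubspace_map,
    Submodule.map_le_map_iff_of_injective (TensorProduct.congr g h).injective] at h'
  obtain ⟨h1, h2⟩ := hmin _ _ h'
  rw [← hA', ← hB']
  exact ⟨Submodule.map_mono h1, Submodule.map_mono h2⟩

/-- Both columns are invariant under K, so they need checking only on the solution spaces of the
canonical pencils. -/
lemma table_of_mem_dualOrbit {l : Label} {U : Submodule F (V F)} (hU : U ∈ dualOrbit F l)
    (h : ∀ C ∈ pencil F l, TableIntersection (pg (solutions C) ∩ segre F) l ∧
      MinSegre (solutions C) (tableMin l).1 (tableMin l).2) :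
    TableIntersection (pg U ∩ segre F) l ∧ MinSegre U (tableMin l).1 (tableMin l).2 := by
  obtain ⟨C, hC, e⟩ := hU
  obtain ⟨h1, h2⟩ := h C hC
  have e' : U ∈ subspaceOrbit (solutions C) := by
    rw [mem_subspaceOrbit_iff_dualOf, dualOf_solutions]; exact e
  obtain ⟨g, k, rfl⟩ := e'
  refine ⟨?_, h2.map g k⟩
  -- The preimage under the inverse collineation is the image under the collineation, which carries
  -- the canonical solution space to the given one.
  have := h1.preimage g.symm k.symm
  rw [Set.preimage_inter, preimage_pg, preimage_segre] at this
  exact this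

/-! ### Sets of points of rank one -/

/-- The points `⟨a ⊗ b⟩` for nonzero `a` and `b` subject to a condition. -/
def rankOnePoints (r : (Fin 2 → F) → (Fin 3 → F) → Prop) : Set (ℙ F (V F)) :=
  {p | ∃ a b, a ≠ 0 ∧ b ≠ 0 ∧ r a b ∧ p.submodule = Submodule.span F {a ⊗ₜ[F] b}}

lemma rankOnePoints_union (r s : (Fin 2 → F) → (Fin 3 → F) → Prop) :
    rankOnePoints r ∪ rankOnePoints s = rankOnePoints fun a b => r a b ∨ s a b := by
  ext p
  constructor
  · rintro (⟨a, b, ha, hb, h, e⟩ | ⟨a, b, ha, hb, h, e⟩)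
    · exact ⟨a, b, ha, hb, .inl h, e⟩
    · exact ⟨a, b, ha, hb, .inr h, e⟩
  · rintro ⟨a, b, ha, hb, h | h, e⟩
    · exact .inl ⟨a, b, ha, hb, h, e⟩
    · exact .inr ⟨a, b, ha, hb, h, e⟩

lemma fin_two_ne_zero {a : Fin 2 → F} : a ≠ 0 ↔ ¬ (a 0 = 0 ∧ a 1 = 0) := by
  rw [ne_eq, not_iff_not]
  exact ⟨by rintro rfl; simp, fun h => funext fun i => by fin_cases i <;> simp [h]⟩

lemma fin_three_ne_zero {b : Fin 3 → F} : b ≠ 0 ↔ ¬ (b 0 = 0 ∧ b 1 = 0 ∧ b 2 = 0) := by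
  rw [ne_eq, not_iff_not]
  exact ⟨by rintro rfl; simp, fun h => funext fun i => by fin_cases i <;> simp [h]⟩

lemma rankOnePoints_congr {r s : (Fin 2 → F) → (Fin 3 → F) → Prop}
    (h : ∀ a b, ¬ (a 0 = 0 ∧ a 1 = 0) → ¬ (b 0 = 0 ∧ b 1 = 0 ∧ b 2 = 0) → (r a b ↔ s a b)) :
    rankOnePoints r = rankOnePoints s := by
  ext p
  constructor
  · rintro ⟨a, b, ha, hb, hr, e⟩
    exact ⟨a, b, ha, hb, (h a b (fin_two_ne_zero.1 ha) (fin_three_ne_zero.1 hb)).1 hr, e⟩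
  · rintro ⟨a, b, ha, hb, hr, e⟩
    exact ⟨a, b, ha, hb, (h a b (fin_two_ne_zero.1 ha) (fin_three_ne_zero.1 hb)).2 hr, e⟩

lemma pg_solutions_inter_segre (W : Submodule F (Mat F)) :
    pg (solutions W) ∩ segre F =
      rankOnePoints fun a b => Matrix.vecMulVec a b ∈ mperp W := by
  ext p
  constructor
  · rintro ⟨h, a, b, ha, hb, -, e⟩
    refine ⟨a, b, ha, hb, ?_, e⟩
    change p.submodule ≤ _ at h
    rw [e, Submodule.span_singleton_le_iff_mem] at h
    exact h
  · rintro ⟨a, b, ha, hb, h, e⟩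
    refine ⟨?_, a, b, ha, hb, trivial, e⟩
    change p.submodule ≤ _
    rw [e, Submodule.span_singleton_le_iff_mem]
    exact h

lemma tmul_ne_zero {a : Fin 2 → F} {b : Fin 3 → F} (ha : a ≠ 0) (hb : b ≠ 0) :
    a ⊗ₜ[F] b ≠ 0 := by
  intro h
  obtain ⟨i, hi⟩ := Function.ne_iff.1 ha
  obtain ⟨j, hj⟩ := Function.ne_iff.1 hb
  have := congrFun (congrFun (congrArg toMat h) i) j
  simp [Matrix.vecMulVec_apply] at this
  exact this.elim hi hj

lemma exists_smul_of_span_tmul_eq {a a' : Fin 2 → F} {b b' : Fin 3 → F} (ha : a ≠ 0) (hb : b ≠ 0)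
    (h : Submodule.span F {a ⊗ₜ[F] b} = Submodule.span F {a' ⊗ₜ[F] b'}) :
    (∃ c : F, a = c • a') ∧ ∃ d : F, b = d • b' := by
  have hm : a ⊗ₜ[F] b ∈ Submodule.span F {a' ⊗ₜ[F] b'} := h ▸ Submodule.mem_span_singleton_self _
  obtain ⟨k, hk⟩ := Submodule.mem_span_singleton.1 hm
  have e : ∀ i j, k * (a' i * b' j) = a i * b j := fun i j => by
    have := congrFun (congrFun (congrArg toMat hk) i) j
    simpa [Matrix.vecMulVec_apply] using this
  obtain ⟨i, hi⟩ := Function.ne_iff.1 ha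
  obtain ⟨j, hj⟩ := Function.ne_iff.1 hb
  simp only [Pi.zero_apply] at hi hj
  refine ⟨⟨k * b' j / b j, ?_⟩, ⟨k * a' i / a i, ?_⟩⟩
  · ext i'
    rw [Pi.smul_apply, smul_eq_mul]
    field_simp
    linear_combination -e i' j
  · ext j'
    rw [Pi.smul_apply, smul_eq_mul]
    field_simp
    linear_combination -e i j'

/-- A point fixes its factors only up to scalars, so testing the condition on a chosen pair requires
stability under scaling. -/
lemma mk_mem_rankOnePoints {r : (Fin 2 → F) → (Fin 3 → F) → Prop}
    (hr : ∀ a b (c d : F), r a b → r (c • a) (d • b)) {a : Fin 2 → F} {b : Fin 3 → F}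
    (ha : a ≠ 0) (hb : b ≠ 0) :
    Projectivization.mk F (a ⊗ₜ[F] b) (tmul_ne_zero ha hb) ∈ rankOnePoints r ↔ r a b := by
  constructor
  · rintro ⟨a', b', ha', hb', h, e⟩
    rw [Projectivization.submodule_mk] at e
    obtain ⟨⟨c, hc⟩, ⟨d, hd⟩⟩ := exists_smul_of_span_tmul_eq ha hb e
    rw [hc, hd]
    exact hr _ _ _ _ h
  · exact fun h => ⟨a, b, ha, hb, h, Projectivization.submodule_mk _ _⟩

lemma pg_eq_of_subset {U : Submodule F (V F)} {S : Set (ℙ F (V F))}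
    (h₁ : ∀ t ∈ U, (ht : t ≠ 0) → Projectivization.mk F t ht ∈ S)
    (h₂ : ∀ p ∈ S, p.submodule ≤ U) : S = pg U := by
  refine Set.Subset.antisymm h₂ fun p hp => ?_
  induction p using Projectivization.ind with
  | h v hv =>
    refine h₁ v ?_ hv
    change (Projectivization.mk F v hv).submodule ≤ U at hp
    rwa [Projectivization.submodule_mk, Submodule.span_singleton_le_iff_mem] at hp

lemma rankOnePoints_left (a₀ : Fin 2 → F) (ha₀ : a₀ ≠ 0) (B : Submodule F (Fin 3 → F)) :
    ∃ L : Submodule F (V F), Module.finrank F L = Module.finrank F B ∧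
      rankOnePoints (fun a b => (∃ c : F, a = c • a₀) ∧ b ∈ B) = pg L := by
  have hinj : Function.Injective (TensorProduct.mk F (Fin 2 → F) (Fin 3 → F) a₀) := by
    rw [injective_iff_map_eq_zero]
    intro b h
    by_contra hb
    exact tmul_ne_zero ha₀ hb h
  refine ⟨B.map (TensorProduct.mk F (Fin 2 → F) (Fin 3 → F) a₀),
    (Submodule.equivMapOfInjective _ hinj B).finrank_eq.symm, pg_eq_of_subset ?_ ?_⟩
  · rintro _ ⟨b, hb, rfl⟩ h0
    exact ⟨a₀, b, ha₀, by rintro rfl; simp at h0, ⟨⟨1, by simp⟩, hb⟩,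
      Projectivization.submodule_mk _ _⟩
  · rintro p ⟨_, b, -, -, ⟨⟨c, rfl⟩, hb⟩, e⟩
    rw [e, Submodule.span_singleton_le_iff_mem, TensorProduct.smul_tmul]
    exact ⟨c • b, B.smul_mem c hb, rfl⟩

lemma rankOnePoints_right (b₀ : Fin 3 → F) (hb₀ : b₀ ≠ 0) :
    IsLine (rankOnePoints fun _ b => ∃ c : F, b = c • b₀) := by
  have hinj : Function.Injective ((TensorProduct.mk F (Fin 2 → F) (Fin 3 → F)).flip b₀) := by
    rw [injective_iff_map_eq_zero]
    intro a h
    by_contra ha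
    exact tmul_ne_zero ha hb₀ h
  refine ⟨LinearMap.range ((TensorProduct.mk F (Fin 2 → F) (Fin 3 → F)).flip b₀),
    by rw [LinearMap.finrank_range_of_inj hinj]; simp, pg_eq_of_subset ?_ ?_⟩
  · rintro _ ⟨a, rfl⟩ h0
    exact ⟨a, b₀, by rintro rfl; simp at h0, hb₀, ⟨1, by simp⟩,
      Projectivization.submodule_mk _ _⟩
  · rintro p ⟨a, _, -, -, ⟨c, rfl⟩, e⟩
    rw [e, Submodule.span_singleton_le_iff_mem, ← TensorProduct.smul_tmul]
    exact ⟨c • a, rfl⟩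

lemma finrank_ker_proj (j : Fin 3) :
    Module.finrank F (LinearMap.ker (LinearMap.proj (R := F) (φ := fun _ : Fin 3 => F) j)) = 2 := by
  have h := LinearMap.finrank_range_add_finrank_ker
    (LinearMap.proj (R := F) (φ := fun _ : Fin 3 => F) j)
  rw [LinearMap.range_eq_top.2 (LinearMap.proj_surjective j), finrank_top] at h
  simp at h
  omega

lemma exists_smul_single_iff (i k : Fin 2) (hik : ∀ m, m = i ∨ m = k) (h : i ≠ k)
    (a : Fin 2 → F) : (∃ c : F, a = c • Pi.single i 1) ↔ a k = 0 := by
  constructor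
  · rintro ⟨c, rfl⟩; simp [h.symm]
  · intro ha
    refine ⟨a i, funext fun m => ?_⟩
    rcases hik m with rfl | rfl
    · simp
    · simp [ha, h.symm]

lemma isLine_left (i k : Fin 2) (hik : ∀ m, m = i ∨ m = k) (h : i ≠ k) (j : Fin 3) :
    IsLine (rankOnePoints (F := F) fun a b => a k = 0 ∧ b j = 0) := by
  obtain ⟨L, hL, e⟩ := rankOnePoints_left (Pi.single i (1 : F)) (by simp)
    (LinearMap.ker (LinearMap.proj (R := F) (φ := fun _ : Fin 3 => F) j))
  refine ⟨L, by rw [hL, finrank_ker_proj], ?_⟩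
  rw [← e]
  simp only [exists_smul_single_iff i k hik h, LinearMap.mem_ker, LinearMap.proj_apply]

lemma isPlane_left : IsPlane (rankOnePoints (F := F) fun a _ => a 0 = 0) := by
  obtain ⟨L, hL, e⟩ := rankOnePoints_left (Pi.single 1 (1 : F)) (by simp) ⊤
  refine ⟨L, by rw [hL]; simp, ?_⟩
  rw [← e]
  simp only [exists_smul_single_iff (1 : Fin 2) 0 (by decide) (by decide), Submodule.mem_top,
    and_true]

lemma isLine_right : IsLine (rankOnePoints (F := F) fun _ b => b 0 = 0 ∧ b 1 = 0) := by
  convert rankOnePoints_right (Pi.single 2 (1 : F)) (by simp) using 4 with a b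
  constructor
  · rintro ⟨h0, h1⟩
    refine ⟨b 2, funext fun j => ?_⟩
    fin_cases j <;> simp [h0, h1]
  · rintro ⟨c, rfl⟩; simp

lemma isSegre22_zero : IsSegre22 (rankOnePoints (F := F) fun _ b => b 0 = 0) :=
  ⟨LinearMap.ker (LinearMap.proj (R := F) (φ := fun _ : Fin 3 => F) 0), finrank_ker_proj 0, rfl⟩

lemma rankOnePoints_ne {r s : (Fin 2 → F) → (Fin 3 → F) → Prop}
    (hs : ∀ a b (c d : F), s a b → s (c • a) (d • b)) (a : Fin 2 → F) (b : Fin 3 → F)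
    (ha : a ≠ 0) (hb : b ≠ 0) (h₁ : r a b) (h₂ : ¬ s a b) :
    ¬ rankOnePoints r ⊆ rankOnePoints s := fun h =>
  h₂ ((mk_mem_rankOnePoints hs ha hb).1
    (h ⟨a, b, ha, hb, h₁, Projectivization.submodule_mk _ (tmul_ne_zero ha hb)⟩))

/-- A parametrisation of the set of points must reach every admissible pair up to scaling. All the
scalar freedom is put into b, which allows the parameters to reproduce a exactly. -/
lemma rankOnePoints_eq_param {ι : Type*} {r : (Fin 2 → F) → (Fin 3 → F) → Prop} {q : ι → Prop}
    (t : ι → V F) (x : ι → Fin 2 → F) (y : ι → Fin 3 → F) (ht : ∀ i, t i = x i ⊗ₜ[F] y i)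
    (h₁ : ∀ i, q i → x i ≠ 0 ∧ y i ≠ 0 ∧ r (x i) (y i))
    (h₂ : ∀ a b, a ≠ 0 → b ≠ 0 → r a b → ∃ i, q i ∧ x i = a ∧ ∃ k : F, b = k • y i) :
    rankOnePoints r = {p | ∃ i, q i ∧ p.submodule = Submodule.span F {t i}} := by
  ext p
  constructor
  · rintro ⟨a, b, ha, hb, h, e⟩
    obtain ⟨i, hi, rfl, k, rfl⟩ := h₂ a b ha hb h
    refine ⟨i, hi, ?_⟩
    have hk : k ≠ 0 := by rintro rfl; simp at hb
    rw [e, ht, TensorProduct.tmul_smul]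
    exact Submodule.span_singleton_smul_eq hk.isUnit _
  · rintro ⟨i, hi, e⟩
    obtain ⟨h, h', h''⟩ := h₁ i hi
    exact ⟨x i, y i, h, h', h'', by rw [e, ht]⟩

/-! ### The column of intersections -/

lemma toMat_smul_sum_injective {n : ℕ} {f : Fin n → Mat F}
    (h : ∀ c : Fin n → F, ∑ i, c i • f i = 0 → ∀ i, c i = 0) :
    LinearIndependent F fun i => toTensor (f i) := by
  rw [Fintype.linearIndependent_iff]
  intro c hc
  refine h c ?_
  simpa using congrArg toMat hc

/-- For given a the equations determine b up to a scalar as (a₀, 0, −a₁). The vectors of the conic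
are the coefficients of a₀², a₀a₁, a₁² in a ⊗ b. -/
lemma isConic_rankOnePoints :
    IsConic (rankOnePoints (F := F) fun a b => b 1 = 0 ∧ a 0 * b 2 + a 1 * b 0 = 0) := by
  refine ⟨fun i => toTensor (![!![1, 0, 0; 0, 0, 0], !![0, 0, -1; 1, 0, 0],
    !![0, 0, 0; 0, 0, -1]] i), toMat_smul_sum_injective fun c hc i => ?_, ?_⟩
  · simp [Fin.sum_univ_three, mat_ext_iff] at hc
    fin_cases i <;> simp [hc]
  · rw [rankOnePoints_eq_param (ι := F × F) (q := fun i => i.1 ≠ 0 ∨ i.2 ≠ 0)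
      (t := fun i => ∑ j : Fin (2 + 1), (i.1 ^ (2 - (j : ℕ)) * i.2 ^ (j : ℕ)) •
        toTensor (![!![1, 0, 0; 0, 0, 0], !![0, 0, -1; 1, 0, 0], !![0, 0, 0; 0, 0, -1]] j))
      (fun i => ![i.1, i.2]) (fun i => ![i.1, 0, -i.2])]
    · simp only [Prod.exists]
    · rintro ⟨a, b⟩
      apply toMat.injective
      ext i j
      fin_cases i <;> fin_cases j <;>
        simp [Fin.sum_univ_three, Matrix.vecMulVec_apply, pow_two, mul_comm]
    · rintro ⟨a, b⟩ h
      simp at h ⊢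
      refine ⟨by tauto, ?_⟩
      ring
    · rintro a b ha hb ⟨h1, h2⟩
      rw [fin_two_ne_zero, not_and_or] at ha
      refine ⟨(a 0, a 1), ha, by ext i; fin_cases i <;> rfl, ?_⟩
      by_cases h0 : a 0 = 0
      · have h1' : a 1 ≠ 0 := by simpa [h0] using ha
        have hb0 : b 0 = 0 := by simpa [h0, h1'] using h2
        refine ⟨-b 2 / a 1, ?_⟩
        ext j
        fin_cases j <;> simp [h0, h1, hb0, h1']
      · refine ⟨b 0 / a 0, ?_⟩
        ext j
        fin_cases j <;> simp [h1, h0]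
        field_simp
        linear_combination h2

/-- The two equations make b orthogonal to (a₀, a₁, 0) and (0, a₀, a₁), hence proportional to their
cross product (a₁², −a₀a₁, a₀²). Then a ⊗ b is cubic in a. -/
lemma isNormalRationalCurve_rankOnePoints :
    IsNormalRationalCurve 3 (rankOnePoints (F := F) fun a b =>
      a 0 * b 0 + a 1 * b 1 = 0 ∧ a 0 * b 1 + a 1 * b 2 = 0) := by
  refine ⟨fun i => toTensor (![!![0, 0, 1; 0, 0, 0], !![0, -1, 0; 0, 0, 1],
    !![1, 0, 0; 0, -1, 0], !![0, 0, 0; 1, 0, 0]] i),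
    toMat_smul_sum_injective fun c hc i => ?_, ?_⟩
  · simp [Fin.sum_univ_four, mat_ext_iff] at hc
    fin_cases i <;> simp [hc]
  · rw [rankOnePoints_eq_param (ι := F × F) (q := fun i => i.1 ≠ 0 ∨ i.2 ≠ 0)
      (t := fun i => ∑ j : Fin (3 + 1), (i.1 ^ (3 - (j : ℕ)) * i.2 ^ (j : ℕ)) •
        toTensor (![!![0, 0, 1; 0, 0, 0], !![0, -1, 0; 0, 0, 1],
          !![1, 0, 0; 0, -1, 0], !![0, 0, 0; 1, 0, 0]] j))
      (fun i => ![i.1, i.2]) (fun i => ![i.2 ^ 2, -(i.1 * i.2), i.1 ^ 2])]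
    · simp only [Prod.exists]
    · rintro ⟨a, b⟩
      apply toMat.injective
      ext i j
      fin_cases i <;> fin_cases j <;>
        simp [Fin.sum_univ_four, Matrix.vecMulVec_apply] <;> ring
    · rintro ⟨a, b⟩ h
      simp at h ⊢
      exact ⟨by tauto, by tauto, by ring, by ring⟩
    · rintro a b ha hb ⟨h1, h2⟩
      rw [fin_two_ne_zero, not_and_or] at ha
      refine ⟨(a 0, a 1), ha, by ext i; fin_cases i <;> rfl, ?_⟩
      by_cases h0 : a 0 = 0
      · have h1' : a 1 ≠ 0 := by simpa [h0] using ha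
        have hb1 : b 1 = 0 := by simpa [h0, h1'] using h1
        have hb2 : b 2 = 0 := by simpa [h0, h1'] using h2
        refine ⟨b 0 / a 1 ^ 2, ?_⟩
        ext j
        fin_cases j <;> simp [h0, hb1, hb2, h1']
      · have e1 : b 1 = -(a 1 * b 2) / a 0 := by field_simp; linear_combination h2
        have e0 : b 0 = -(a 1 * b 1) / a 0 := by field_simp; linear_combination h1
        refine ⟨b 2 / a 0 ^ 2, ?_⟩
        ext j
        fin_cases j <;> simp [e0, e1, h0] <;> field_simp

/-- For given a the solutions are b = (ta₁, −ta₀, s). In a ⊗ b the part with s traces a line and the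
part with t a conic, and a pairs their points. -/
lemma isCubicScroll_rankOnePoints :
    IsCubicScroll (rankOnePoints (F := F) fun a b => a 0 * b 0 + a 1 * b 1 = 0) := by
  refine ⟨fun i => toTensor (![!![0, 0, 1; 0, 0, 0], !![0, 0, 0; 0, 0, 1]] i),
    fun i => toTensor (![!![0, -1, 0; 0, 0, 0], !![1, 0, 0; 0, -1, 0], !![0, 0, 0; 1, 0, 0]] i),
    ?_, ?_⟩
  · rw [Fintype.linearIndependent_iff]
    intro c hc
    have := congrArg toMat hc
    simp [Fin.sum_univ_two, Fin.sum_univ_three, mat_ext_iff] at this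
    rintro (i | i) <;> fin_cases i <;> simp [this]
  · rw [rankOnePoints_eq_param (ι := F × F × F × F)
      (q := fun i => (i.1 ≠ 0 ∨ i.2.1 ≠ 0) ∧ (i.2.2.1 ≠ 0 ∨ i.2.2.2 ≠ 0))
      (t := fun i => i.2.2.1 • (i.1 • toTensor !![0, 0, 1; 0, 0, 0] +
        i.2.1 • toTensor !![0, 0, 0; 0, 0, 1]) + i.2.2.2 • (i.1 ^ 2 •
        toTensor !![0, -1, 0; 0, 0, 0] + (i.1 * i.2.1) • toTensor !![1, 0, 0; 0, -1, 0] +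
        i.2.1 ^ 2 • toTensor !![0, 0, 0; 1, 0, 0]))
      (fun i => ![i.1, i.2.1]) (fun i => ![i.2.2.2 * i.2.1, -(i.2.2.2 * i.1), i.2.2.1])]
    · simp only [Prod.exists, and_assoc]
      rfl
    · rintro ⟨a, b, s, t⟩
      apply toMat.injective
      ext i j
      fin_cases i <;> fin_cases j <;> simp [Matrix.vecMulVec_apply] <;> ring
    · rintro ⟨a, b, s, t⟩ ⟨h, h'⟩
      simp at h h' ⊢
      refine ⟨by tauto, by tauto, by ring⟩
    · rintro a b ha hb h1
      rw [fin_two_ne_zero, not_and_or] at ha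
      rw [fin_three_ne_zero] at hb
      by_cases h0 : a 0 = 0
      · have h1' : a 1 ≠ 0 := by simpa [h0] using ha
        have hb1 : b 1 = 0 := by simpa [h0, h1'] using h1
        refine ⟨(a 0, a 1, b 2, b 0 / a 1), ⟨ha, ?_⟩, by ext i; fin_cases i <;> rfl, 1, ?_⟩
        · simp [h1']; tauto
        · ext j
          fin_cases j <;> simp [h0, hb1, h1']
      · have e0 : b 0 = -(a 1 * b 1) / a 0 := by field_simp; linear_combination h1
        refine ⟨(a 0, a 1, b 2, -b 1 / a 0), ⟨ha, ?_⟩, by ext i; fin_cases i <;> rfl, 1, ?_⟩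
        · simp [h0]
          by_contra! hc
          apply hb
          simp [hc, e0]
        · ext j
          fin_cases j <;> simp [e0, h0]
          ring

lemma of_rankOnePoints_congr {p : Set (ℙ F (V F)) → Prop}
    {r s : (Fin 2 → F) → (Fin 3 → F) → Prop} (hs : p (rankOnePoints s))
    (h : ∀ a b, ¬ (a 0 = 0 ∧ a 1 = 0) → ¬ (b 0 = 0 ∧ b 1 = 0 ∧ b 2 = 0) → (r a b ↔ s a b)) :
    p (rankOnePoints r) := by
  rwa [rankOnePoints_congr h]

lemma tableIntersection_solutions {l : Label} {C : Submodule F (Mat F)} (hC : C ∈ pencil F l) :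
    TableIntersection (pg (solutions C) ∩ segre F) l := by
  rw [pg_solutions_inter_segre]
  cases l
  case o1 =>
    obtain rfl := hC
    refine ⟨_, _, isPlane_left, isSegre22_zero, ?_⟩
    rw [rankOnePoints_union]
    refine rankOnePoints_congr fun a b ha hb => ?_
    simp [mem_mperp_singleton, matForm_eq, Matrix.vecMulVec_apply]
  case o2 =>
    obtain rfl := hC
    refine ⟨_, _, isPlane_left, isLine_right, ?_, ?_⟩
    · exact rankOnePoints_ne (by simp +contextual) ![1, 0] ![0, 0, 1] (by simp) (by simp)
        (by simp) (by simp)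
    · rw [rankOnePoints_union]
      refine rankOnePoints_congr fun a b ha hb => ?_
      simp [mem_mperp_pair, matForm_eq, Matrix.vecMulVec_apply]
      tauto
  case o4 =>
    obtain rfl := hC
    refine of_rankOnePoints_congr isCubicScroll_rankOnePoints fun a b ha hb => ?_
    simp [mem_mperp_singleton, matForm_eq, Matrix.vecMulVec_apply]
  case o4T =>
    obtain rfl := hC
    refine of_rankOnePoints_congr isSegre22_zero fun a b ha hb => ?_
    simp [mem_mperp_pair, matForm_eq, Matrix.vecMulVec_apply]
    tauto
  case o5 =>
    obtain rfl := hC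
    refine ⟨_, _, _, isLine_left 1 0 (by decide) (by decide) 1,
      isLine_left 0 1 (by decide) (by decide) 0, isLine_right, ?_, ?_, ?_, ?_⟩
    · exact fun h => rankOnePoints_ne (by simp +contextual) ![0, 1] ![1, 0, 0] (by simp) (by simp)
        (by simp) (by simp) h.subset
    · exact fun h => rankOnePoints_ne (by simp +contextual) ![0, 1] ![1, 0, 0] (by simp) (by simp)
        (by simp) (by simp) h.subset
    · exact fun h => rankOnePoints_ne (by simp +contextual) ![1, 0] ![0, 1, 0] (by simp) (by simp)
        (by simp) (by simp) h.subset
    · rw [rankOnePoints_union, rankOnePoints_union]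
      refine rankOnePoints_congr fun a b ha hb => ?_
      simp [mem_mperp_pair, matForm_eq, Matrix.vecMulVec_apply]
      tauto
  case o6 =>
    obtain rfl := hC
    refine ⟨_, _, isLine_left 0 1 (by decide) (by decide) 0, isLine_right, ?_, ?_, ?_⟩
    · exact fun h => rankOnePoints_ne (by simp +contextual) ![1, 0] ![0, 1, 0] (by simp) (by simp)
        (by simp) (by simp) h.subset
    · refine ⟨Projectivization.mk F (![1, 0] ⊗ₜ[F] ![0, 0, 1])
        (tmul_ne_zero (by simp) (by simp)), ?_, ?_⟩
      · rw [mk_mem_rankOnePoints (by simp +contextual) (by simp) (by simp)]; simp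
      · rw [mk_mem_rankOnePoints (by simp +contextual) (by simp) (by simp)]; simp
    · rw [rankOnePoints_union]
      refine rankOnePoints_congr fun a b ha hb => ?_
      simp [mem_mperp_pair, matForm_eq, Matrix.vecMulVec_apply]
      constructor
      · rintro ⟨h1, h2 | h2⟩
        · left; simp_all
        · by_cases h : a 1 = 0
          · exact .inl ⟨h, h2⟩
          · right; simp_all
      · rintro (⟨h1, h2⟩ | ⟨h1, h2⟩) <;> simp [h1, h2]
  case o7 =>
    obtain rfl := hC
    refine ⟨_, _, isConic_rankOnePoints, isLine_left 0 1 (by decide) (by decide) 2, ?_⟩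
    rw [rankOnePoints_union]
    refine rankOnePoints_congr fun a b ha hb => ?_
    simp [mem_mperp_pair, matForm_eq, Matrix.vecMulVec_apply]
    constructor
    · rintro ⟨h1, h2 | h2⟩
      · right; simp_all
      · exact .inl ⟨h2, h1⟩
    · rintro (⟨h1, h2⟩ | ⟨h1, h2⟩)
      · exact ⟨h2, .inr h1⟩
      · simp [h1, h2]
  case o10 =>
    obtain ⟨u, v, h, rfl⟩ := hC
    refine of_rankOnePoints_congr isLine_right fun a b ha hb => ?_
    simp [mem_mperp_pair, matForm_eq, Matrix.vecMulVec_apply]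
    constructor
    · rintro ⟨h1, h2⟩
      -- For fixed a, the conditions are a linear system in b₀ and b₁ whose determinant is nonzero
      -- by `NoRoot`; Cramer's rule gives b₀ = b₁ = 0.
      have hd : a 0 * a 0 ≠ (a 0 * u + a 1) * (a 1 * v) := fun hd => ha (eq_zero_of_minors h hd)
      refine ⟨mul_left_cancel₀ (sub_ne_zero.2 hd) ?_, mul_left_cancel₀ (sub_ne_zero.2 hd) ?_⟩
      · linear_combination a 0 * h1 - (a 0 * u + a 1) * h2
      · linear_combination a 0 * h2 - v * a 1 * h1
    · rintro ⟨h1, h2⟩; simp [h1, h2]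
  case o11 =>
    obtain rfl := hC
    refine of_rankOnePoints_congr isNormalRationalCurve_rankOnePoints fun a b ha hb => ?_
    simp [mem_mperp_pair, matForm_eq, Matrix.vecMulVec_apply]

/-! ### The column of minimal Segre varieties -/

/-- Multiplying abᵀ by c gives a multiple of a. Hence any Segre span containing U has a left factor
containing all columns of members of U, and likewise a right factor containing all rows. -/
lemma mulVec_mem_of_mem_tensorSubspace {A : Submodule F (Fin 2 → F)}
    {B : Submodule F (Fin 3 → F)} {t : V F} (ht : t ∈ tensorSubspace A B) (c : Fin 3 → F) :
    (toMat t).mulVec c ∈ A := by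
  have : tensorSubspace A B ≤ A.comap
      ({ toFun := fun t => (toMat t).mulVec c
         map_add' := fun s t => by rw [map_add, Matrix.add_mulVec]
         map_smul' := fun k t => by rw [map_smul, Matrix.smul_mulVec]; rfl } :
        V F →ₗ[F] (Fin 2 → F)) := by
    refine Submodule.map₂_le.2 fun a ha b _ => ?_
    change (Matrix.vecMulVec a b).mulVec c ∈ A
    rw [Matrix.vecMulVec_mulVec]
    rw [op_smul_eq_smul]
    exact A.smul_mem _ ha
  exact this ht

lemma vecMul_mem_of_mem_tensorSubspace {A : Submodule F (Fin 2 → F)}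
    {B : Submodule F (Fin 3 → F)} {t : V F} (ht : t ∈ tensorSubspace A B) (c : Fin 2 → F) :
    Matrix.vecMul c (toMat t) ∈ B := by
  have : tensorSubspace A B ≤ B.comap
      ({ toFun := fun t => Matrix.vecMul c (toMat t)
         map_add' := fun s t => by rw [map_add, Matrix.vecMul_add]
         map_smul' := fun k t => by rw [map_smul, Matrix.vecMul_smul]; rfl } :
        V F →ₗ[F] (Fin 3 → F)) := by
    refine Submodule.map₂_le.2 fun a _ b hb => ?_
    change Matrix.vecMul c (Matrix.vecMulVec a b) ∈ B
    rw [Matrix.vecMul_vecMulVec]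
    exact B.smul_mem _ hb
  exact this ht

/-- `A` contains all columns of solutions of `W`. -/
lemma mem_left_of_solutions_le {W : Submodule F (Mat F)} {A : Submodule F (Fin 2 → F)}
    {B : Submodule F (Fin 3 → F)} (h : solutions W ≤ tensorSubspace A B) {M : Mat F}
    (hM : M ∈ mperp W) (j : Fin 3) {a : Fin 2 → F} (h₀ : M 0 j = a 0) (h₁ : M 1 j = a 1) :
    a ∈ A := by
  have := mulVec_mem_of_mem_tensorSubspace (h (toTensor_mem_solutions.2 hM)) (Pi.single j 1)
  rw [toMat_toTensor, Matrix.mulVec_single_one] at this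
  convert this using 1
  ext i
  fin_cases i
  exacts [h₀.symm, h₁.symm]

/-- `B` contains all combinations of rows of solutions of `W`. -/
lemma mem_right_of_solutions_le {W : Submodule F (Mat F)} {A : Submodule F (Fin 2 → F)}
    {B : Submodule F (Fin 3 → F)} (h : solutions W ≤ tensorSubspace A B) {M : Mat F}
    (hM : M ∈ mperp W) (c : Fin 2 → F) {b : Fin 3 → F} (hb : Matrix.vecMul c M = b) : b ∈ B := by
  have := vecMul_mem_of_mem_tensorSubspace (h (toTensor_mem_solutions.2 hM)) c
  rwa [toMat_toTensor, hb] at this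

lemma top_le_of_fin_two {A : Submodule F (Fin 2 → F)} (h0 : ![1, 0] ∈ A) (h1 : ![0, 1] ∈ A) :
    ⊤ ≤ A := by
  intro a _
  have : a = a 0 • ![1, 0] + a 1 • ![0, 1] := by ext i; fin_cases i <;> simp
  rw [this]
  exact A.add_mem (A.smul_mem _ h0) (A.smul_mem _ h1)

lemma top_le_of_fin_three {B : Submodule F (Fin 3 → F)} (h0 : ![1, 0, 0] ∈ B)
    (h1 : ![0, 1, 0] ∈ B) (h2 : ![0, 0, 1] ∈ B) : ⊤ ≤ B := by
  intro b _
  have : b = b 0 • ![1, 0, 0] + b 1 • ![0, 1, 0] + b 2 • ![0, 0, 1] := by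
    ext i; fin_cases i <;> simp
  rw [this]
  exact B.add_mem (B.add_mem (B.smul_mem _ h0) (B.smul_mem _ h1)) (B.smul_mem _ h2)

/-- The witnesses exhibit every standard basis vector as a column, respectively as a combination of
rows, of a solution. No proper factor can then occur. -/
lemma minSegre_top {W : Submodule F (Mat F)}
    (h0 : ∃ M ∈ mperp W, ∃ j, M 0 j = 1 ∧ M 1 j = 0)
    (h1 : ∃ M ∈ mperp W, ∃ j, M 0 j = 0 ∧ M 1 j = 1)
    (k0 : ∃ M ∈ mperp W, ∃ c, Matrix.vecMul c M = ![1, 0, 0])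
    (k1 : ∃ M ∈ mperp W, ∃ c, Matrix.vecMul c M = ![0, 1, 0])
    (k2 : ∃ M ∈ mperp W, ∃ c, Matrix.vecMul c M = ![0, 0, 1]) :
    MinSegre (solutions W) 2 3 := by
  refine ⟨⊤, ⊤, by simp, by simp, ?_, fun A' B' h => ⟨?_, ?_⟩⟩
  · rw [tensorSubspace, TensorProduct.map₂_mk_top_top_eq_top]
    exact le_top
  · obtain ⟨M, hM, j, h0, h0'⟩ := h0
    obtain ⟨N, hN, k, h1, h1'⟩ := h1
    exact top_le_of_fin_two (mem_left_of_solutions_le h hM j h0 h0')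
      (mem_left_of_solutions_le h hN k h1 h1')
  · obtain ⟨M, hM, c, hc⟩ := k0
    obtain ⟨N, hN, d, hd⟩ := k1
    obtain ⟨L, hL, e, he⟩ := k2
    exact top_le_of_fin_three (mem_right_of_solutions_le h hM c hc)
      (mem_right_of_solutions_le h hN d hd) (mem_right_of_solutions_le h hL e he)

lemma minSegre_solutions {l : Label} {C : Submodule F (Mat F)} (hC : C ∈ pencil F l) :
    MinSegre (solutions C) (tableMin l).1 (tableMin l).2 := by
  cases l
  case o1 =>
    obtain rfl := hC
    refine minSegre_top ⟨!![0, 0, 1; 0, 0, 0], ?_, 2, ?_, ?_⟩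
      ⟨!![0, 0, 0; 0, 0, 1], ?_, 2, ?_, ?_⟩ ⟨!![0, 0, 0; 1, 0, 0], ?_, ![0, 1], ?_⟩
      ⟨!![0, 0, 0; 0, 1, 0], ?_, ![0, 1], ?_⟩ ⟨!![0, 0, 0; 0, 0, 1], ?_, ![0, 1], ?_⟩ <;>
      simp [mem_mperp_singleton, matForm_eq]
  case o2 =>
    obtain rfl := hC
    refine minSegre_top ⟨!![0, 0, 1; 0, 0, 0], ?_, 2, ?_, ?_⟩
      ⟨!![0, 0, 0; 0, 0, 1], ?_, 2, ?_, ?_⟩ ⟨!![0, 0, 0; 1, 0, 0], ?_, ![0, 1], ?_⟩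
      ⟨!![0, 0, 0; 0, 1, 0], ?_, ![0, 1], ?_⟩ ⟨!![0, 0, 0; 0, 0, 1], ?_, ![0, 1], ?_⟩ <;>
      simp [mem_mperp_pair, matForm_eq]
  case o4 =>
    obtain rfl := hC
    refine minSegre_top ⟨!![0, 0, 1; 0, 0, 0], ?_, 2, ?_, ?_⟩
      ⟨!![0, 0, 0; 0, 0, 1], ?_, 2, ?_, ?_⟩ ⟨!![0, 0, 0; 1, 0, 0], ?_, ![0, 1], ?_⟩
      ⟨!![0, 1, 0; 0, 0, 0], ?_, ![1, 0], ?_⟩ ⟨!![0, 0, 0; 0, 0, 1], ?_, ![0, 1], ?_⟩ <;>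
      simp [mem_mperp_singleton, matForm_eq]
  case o4T =>
    obtain rfl := hC
    refine ⟨⊤, LinearMap.ker (LinearMap.proj (R := F) (φ := fun _ : Fin 3 => F) 0), by simp [tableMin],
      finrank_ker_proj 0, ?_, fun A' B' h => ⟨?_, ?_⟩⟩
    · intro t ht
      rw [mem_solutions, mem_mperp_pair, matForm_eq, matForm_eq] at ht
      simp at ht
      rw [← toTensor_toMat t, toTensor]
      refine Submodule.sum_mem _ fun i _ => Submodule.sum_mem _ fun j _ => ?_
      by_cases hj : j = 0
      · subst hj
        have : toMat t i 0 = 0 := by fin_cases i; exacts [ht.1, ht.2]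
        rw [this, zero_smul]
        exact Submodule.zero_mem _
      · exact Submodule.smul_mem _ _ (Submodule.apply_mem_map₂ _ trivial (by simp [hj]))
    · refine top_le_of_fin_two
        (mem_left_of_solutions_le h (M := !![0, 0, 1; 0, 0, 0]) ?_ 2 ?_ ?_)
        (mem_left_of_solutions_le h (M := !![0, 0, 0; 0, 0, 1]) ?_ 2 ?_ ?_) <;>
        simp [mem_mperp_pair, matForm_eq]
    · intro b hb
      have hb0 : b 0 = 0 := hb
      have : b = b 1 • ![0, 1, 0] + b 2 • ![0, 0, 1] := by
        ext i; fin_cases i <;> simp [hb0]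
      rw [this]
      refine B'.add_mem (B'.smul_mem _
        (mem_right_of_solutions_le h (M := !![0, 1, 0; 0, 0, 0]) ?_ ![1, 0] ?_)) (B'.smul_mem _
        (mem_right_of_solutions_le h (M := !![0, 0, 1; 0, 0, 0]) ?_ ![1, 0] ?_)) <;>
        simp [mem_mperp_pair, matForm_eq]
  case o5 =>
    obtain rfl := hC
    refine minSegre_top ⟨!![0, 0, 1; 0, 0, 0], ?_, 2, ?_, ?_⟩
      ⟨!![0, 0, 0; 0, 0, 1], ?_, 2, ?_, ?_⟩ ⟨!![0, 0, 0; 1, 0, 0], ?_, ![0, 1], ?_⟩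
      ⟨!![0, 1, 0; 0, 0, 0], ?_, ![1, 0], ?_⟩ ⟨!![0, 0, 0; 0, 0, 1], ?_, ![0, 1], ?_⟩ <;>
      simp [mem_mperp_pair, matForm_eq]
  case o6 =>
    obtain rfl := hC
    refine minSegre_top ⟨!![0, 0, 1; 0, 0, 0], ?_, 2, ?_, ?_⟩
      ⟨!![0, 0, 0; 0, 0, 1], ?_, 2, ?_, ?_⟩ ⟨!![1, 0, 0; 0, -1, 0], ?_, ![1, 0], ?_⟩
      ⟨!![0, 1, 0; 0, 0, 0], ?_, ![1, 0], ?_⟩ ⟨!![0, 0, 0; 0, 0, 1], ?_, ![0, 1], ?_⟩ <;>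
      simp [mem_mperp_pair, matForm_eq]
  case o7 =>
    obtain rfl := hC
    refine minSegre_top ⟨!![1, 0, 0; 0, 0, 0], ?_, 0, ?_, ?_⟩
      ⟨!![0, 0, 0; 0, 0, 1], ?_, 2, ?_, ?_⟩ ⟨!![1, 0, 0; 0, 0, 0], ?_, ![1, 0], ?_⟩
      ⟨!![0, 1, 0; 0, 0, 0], ?_, ![1, 0], ?_⟩ ⟨!![0, 0, 0; 0, 0, 1], ?_, ![0, 1], ?_⟩ <;>
      simp [mem_mperp_pair, matForm_eq]
  case o10 =>
    obtain ⟨u, v, -, rfl⟩ := hC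
    refine minSegre_top ⟨!![0, 0, 1; 0, 0, 0], ?_, 2, ?_, ?_⟩
      ⟨!![0, 0, 0; 0, 0, 1], ?_, 2, ?_, ?_⟩ ⟨!![1, 0, 0; 0, -1, 0], ?_, ![1, 0], ?_⟩
      ⟨!![1, 0, 0; 0, -1, 0], ?_, ![0, -1], ?_⟩ ⟨!![0, 0, 0; 0, 0, 1], ?_, ![0, 1], ?_⟩ <;>
      simp [mem_mperp_pair, matForm_eq]
  case o11 =>
    obtain rfl := hC
    refine minSegre_top ⟨!![0, 0, 1; 0, 0, 0], ?_, 2, ?_, ?_⟩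
      ⟨!![0, 0, 0; 1, 0, 0], ?_, 0, ?_, ?_⟩ ⟨!![0, 0, 0; 1, 0, 0], ?_, ![0, 1], ?_⟩
      ⟨!![0, 1, 0; 0, 0, -1], ?_, ![1, 0], ?_⟩ ⟨!![0, 0, 1; 0, 0, 0], ?_, ![1, 0], ?_⟩ <;>
      simp [mem_mperp_pair, matForm_eq]

lemma describedByTables {β₁ : LinearMap.BilinForm F (Fin 2 → F)}
    {β₂ : LinearMap.BilinForm F (Fin 3 → F)} (h₁ : β₁.Nondegenerate) (h₂ : β₂.Nondegenerate) :
    DescribedByTables β₁ β₂ := by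
  intro l
  rw [perpOrbit_eq_dualOrbit h₁ h₂]
  exact ⟨fun R hR => tableRep_subset_dualOrbit l hR, fun U hU => table_of_mem_dualOrbit hU
    fun C hC => ⟨tableIntersection_solutions hC, minSegre_solutions hC⟩⟩

lemma dualOrbit_o10_of_isAlgClosed [IsAlgClosed F] : dualOrbit F .o10 = ∅ := by
  simp [dualOrbit, pencil_o10_of_isAlgClosed]

end

end SegreTwoThree

/-! ### The main theorem. -/

theorem mainTheorem4 :
    (∀ (F : Type u) [Field F] [IsAlgClosed F],
      (SegreTwoThree.solidOrbits F).ncard = 6 ∧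
      (SegreTwoThree.hyperplaneOrbits F).ncard = 2 ∧
      ∀ (β₁ : LinearMap.BilinForm F (Fin 2 → F)) (β₂ : LinearMap.BilinForm F (Fin 3 → F)),
        β₁.IsSymm → β₁.Nondegenerate → β₂.IsSymm → β₂.Nondegenerate →
        SegreTwoThree.perpOrbit β₁ β₂ SegreTwoThree.Label.o10 = ∅ ∧
        Set.BijOn (SegreTwoThree.perpOrbit β₁ β₂)
          (SegreTwoThree.solidLabels \ {SegreTwoThree.Label.o10})
          (SegreTwoThree.solidOrbits F) ∧
        Set.BijOn (SegreTwoThree.perpOrbit β₁ β₂) SegreTwoThree.hyperplaneLabels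
          (SegreTwoThree.hyperplaneOrbits F) ∧
        SegreTwoThree.DescribedByTables β₁ β₂) ∧
    ((SegreTwoThree.solidOrbits ℝ).ncard = 7 ∧
      (SegreTwoThree.hyperplaneOrbits ℝ).ncard = 2 ∧
      ∀ (β₁ : LinearMap.BilinForm ℝ (Fin 2 → ℝ)) (β₂ : LinearMap.BilinForm ℝ (Fin 3 → ℝ)),
        β₁.IsSymm → β₁.Nondegenerate → β₂.IsSymm → β₂.Nondegenerate →
        Set.BijOn (SegreTwoThree.perpOrbit β₁ β₂) SegreTwoThree.solidLabels
          (SegreTwoThree.solidOrbits ℝ) ∧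
        Set.BijOn (SegreTwoThree.perpOrbit β₁ β₂) SegreTwoThree.hyperplaneLabels
          (SegreTwoThree.hyperplaneOrbits ℝ) ∧
        SegreTwoThree.DescribedByTables β₁ β₂) := by
  refine ⟨fun F _ _ => ⟨?_, ?_, fun β₁ β₂ _ h₁ _ h₂ => ?_⟩, ?_, ?_, fun β₁ β₂ _ h₁ _ h₂ => ?_⟩
  -- The counts involve no form β; they are obtained by counting labels through `dualOrbit`.
  · rw [← SegreTwoThree.bijOn_solidOrbits_of_isAlgClosed.image_eq,
      SegreTwoThree.bijOn_solidOrbits_of_isAlgClosed.injOn.ncard_image,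
      SegreTwoThree.ncard_solidLabels_diff_o10]
  · rw [← SegreTwoThree.bijOn_hyperplaneOrbits.image_eq,
      SegreTwoThree.bijOn_hyperplaneOrbits.injOn.ncard_image,
      SegreTwoThree.ncard_hyperplaneLabels]
  · refine ⟨?_, ?_, ?_, SegreTwoThree.describedByTables h₁ h₂⟩ <;>
      rw [SegreTwoThree.perpOrbit_eq_dualOrbit h₁ h₂]
    · exact SegreTwoThree.dualOrbit_o10_of_isAlgClosed
    · exact SegreTwoThree.bijOn_solidOrbits_of_isAlgClosed
    · exact SegreTwoThree.bijOn_hyperplaneOrbits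
  · rw [← SegreTwoThree.bijOn_solidOrbits_real.image_eq,
      SegreTwoThree.bijOn_solidOrbits_real.injOn.ncard_image, SegreTwoThree.ncard_solidLabels]
  · rw [← SegreTwoThree.bijOn_hyperplaneOrbits.image_eq,
      SegreTwoThree.bijOn_hyperplaneOrbits.injOn.ncard_image,
      SegreTwoThree.ncard_hyperplaneLabels]
  · refine ⟨?_, ?_, SegreTwoThree.describedByTables h₁ h₂⟩ <;>
      rw [SegreTwoThree.perpOrbit_eq_dualOrbit h₁ h₂]
    · exact SegreTwoThree.bijOn_solidOrbits_real
    · exact SegreTwoThree.bijOn_hyperplaneOrbits
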